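/- Let $(R,\mathfrak m,k)$ be a local ring (commutative, noetherian, with maximal ideal $\mathfrak m$ and residue field $k$) such that $\mathfrak m^2=0$ and $e=\operatorname{edim}R=\operatorname{rank}_k(\mathfrak m/\mathfrak m^2)\ge 2$. **Notation.** All gradings are by upper (cohomological) degree. Let $F\to k$ be any projective resolution over $R$. Let $\operatorname{Hom}_R(F,F)$ be the DG algebra with $\operatorname{Hom}_R(F,F)^{n}=\prod_i\operatorname{Hom}_R(F_i,F_{i-n})$, differential $\beta\mapsto\partial\beta-(-1)^{|\beta|}\beta\partial$ and product $\alpha\beta=\alpha\circ\beta$. Let $\overline{\operatorname{Hom}}_R(F,F)$ be its DG ideal of bounded homomorphisms (those $\beta$ with $\beta_i=0$ for all $i\gg0$), and put $\widehat{\operatorname{Hom}}_R(F,F)=\operatorname{Hom}_R(F,F)/\overline{\operatorname{Hom}}_R(F,F)$. Let $$\mathcal E=\operatorname{Ext}_R(k,k)=H(\operatorname{Hom}_R(F,F)),\quad \mathcal S=\widehat{\operatorname{Ext}}_R(k,k)=H(\widehat{\operatorname{Hom}}_R(F,F)),\quad \mathcal B=\overline{\operatorname{Ext}}_R(k,k)=H(\overline{\operatorname{Hom}}_R(F,F))$$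 be the absolute and the stable cohomology algebra and the bounded cohomology of $k$. Let $\iota\colon\mathcal E\to\mathcal S$ be the canonical homomorphism of graded algebras, through which $\mathcal S$ is a graded left $\mathcal E$-module, and let $\eth\colon\mathcal S\to\mathsf\Sigma\mathcal B$ be the connecting homomorphism, which is a homomorphism of graded left $\mathcal E$-modules. For a graded left $\mathcal E$-module $\mathcal M$ and $s\in\mathbb Z$, the module $\mathsf\Sigma^s\mathcal M$ has $(\mathsf\Sigma^s\mathcal M)^n=\mathcal M^{n+s}$, with $\varepsilon\in\mathcal E$ acting by $(-1)^{|\varepsilon|s}$ times its action on $\mathcal M$. Let $\mathcal I=\operatorname{Hom}_k(\mathcal E,k)$ be the graded dual, with $\mathcal I^n=\operatorname{Hom}_k(\mathcal E^{-n},k)$ and $(\varepsilon\cdot\varphi)(\varepsilon')=(-1)^{|\varepsilon|(|\varphi|+|\varepsilon'|)}\varphi(\varepsilon'\varepsilon)$. Finally, $k$ also denotes the left $\mathcal E$-module $\mathcal E/\mathcal E^{\ge1}$. **Theorem.** The following assertions hold. 1. There is an isomorphism of graded left $\mathcal E$-modules $$\varphi\colon\mathsf\Sigma\mathcal B\;\cong\;(\mathsf\Sigma\mathcal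 I)^{e}\oplus\coprod_{i=0}^{\infty}(\mathsf\Sigma^{-i}\mathcal I)^{e^{i}(e^2-1)},$$ and with it the sequence of graded left $\mathcal E$-modules $$0\longrightarrow\mathcal E\xrightarrow{\ \iota\ }\mathcal S\xrightarrow{\ \varphi\circ\eth\ }(\mathsf\Sigma\mathcal I)^{e}\oplus\coprod_{i=0}^{\infty}(\mathsf\Sigma^{-i}\mathcal I)^{e^{i}(e^2-1)}\longrightarrow0$$ is exact. 2. The left $\mathcal E$-submodule $\iota(\mathcal E)$ has no direct complement in $\mathcal S$: there is no left $\mathcal E$-submodule $\mathcal T'\subseteq\mathcal S$, graded or not, with $\mathcal S=\iota(\mathcal E)\oplus\mathcal T'$. 3. One has $\operatorname{Ext}^n_{\mathcal E}(k,\mathcal S)=0$ for all $n$, where $\operatorname{Ext}$ is taken over the underlying ring $\bigoplus_n\mathcal E^n$, with values in the underlying module $\bigoplus_n\mathcal S^n$ (this includes the vanishing of the graded $\operatorname{Ext}$). -/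

import Mathlib

open CategoryTheory CochainComplex CochainComplex.HomComplex

universe u

namespace StableExt

/-! ## Graded algebras and graded left modules

Gradings are by upper (cohomological) degree in `ℤ`.  Products are written
`A i → A j → A n` for any `n` with `i + j = n`. -/

/-- A `ℤ`-graded associative unital algebra over a commutative ring `R`. -/
structure GrAlg (R : Type u) [CommRing R] where
  /-- the component of (upper) degree `n` -/
  X : ℤ → Type u
  [grp : ∀ n, AddCommGroup (X n)]
  [mod : ∀ n, Module R (X n)]
  /-- the product -/
  mul : ∀ {i j n : ℤ}, i + j = n → (X i →ₗ[R] X j →ₗ[R] X n)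
  /-- the unit -/
  one : X 0
  one_mul : ∀ {i : ℤ} (a : X i), mul (zero_add i) one a = a
  mul_one : ∀ {i : ℤ} (a : X i), mul (add_zero i) a one = a
  mul_assoc : ∀ {i j l ij jl n : ℤ} (hij : i + j = ij) (hjl : j + l = jl)
    (h : ij + l = n) (h' : i + jl = n) (a : X i) (b : X j) (c : X l),
    mul h (mul hij a b) c = mul h' a (mul hjl b c)

attribute [instance] GrAlg.grp GrAlg.mod

/-- A graded left module over a graded algebra. -/
structure GrMod {R : Type u} [CommRing R] (A : GrAlg R) where
  /-- the component of (upper) degree `n` -/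
  X : ℤ → Type u
  [grp : ∀ n, AddCommGroup (X n)]
  [mod : ∀ n, Module R (X n)]
  /-- the action -/
  act : ∀ {i j n : ℤ}, i + j = n → (A.X i →ₗ[R] X j →ₗ[R] X n)
  one_act : ∀ {i : ℤ} (x : X i), act (zero_add i) A.one x = x
  mul_act : ∀ {i j l ij jl n : ℤ} (hij : i + j = ij) (hjl : j + l = jl)
    (h : ij + l = n) (h' : i + jl = n) (a : A.X i) (b : A.X j) (x : X l),
    act h (A.mul hij a b) x = act h' a (act hjl b x)

attribute [instance] GrMod.grp GrMod.mod

variable {R : Type u} [CommRing R]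

/-- A homomorphism of graded algebras. -/
structure GrAlgHom (A B : GrAlg R) where
  /-- the component of degree `n` -/
  app : ∀ n : ℤ, A.X n →ₗ[R] B.X n
  map_one : app 0 A.one = B.one
  map_mul : ∀ {i j n : ℤ} (h : i + j = n) (a : A.X i) (b : A.X j),
    app n (A.mul h a b) = B.mul h (app i a) (app j b)

/-- A homomorphism (of degree `0`) of graded left modules. -/
structure GrHom {A : GrAlg R} (M N : GrMod A) where
  /-- the component of degree `n` -/
  app : ∀ n : ℤ, M.X n →ₗ[R] N.X n
  map_act : ∀ {i j n : ℤ} (h : i + j = n) (a : A.X i) (x : M.X j),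
    app n (M.act h a x) = N.act h a (app j x)

/-- Composition `g ∘ f` of homomorphisms of graded left modules. -/
def GrHom.comp {A : GrAlg R} {L M N : GrMod A} (g : GrHom M N) (f : GrHom L M) :
    GrHom L N where
  app n := g.app n ∘ₗ f.app n
  map_act h a x := by simp [f.map_act, g.map_act]

/-- A graded algebra as a graded left module over itself. -/
def GrAlg.self (A : GrAlg R) : GrMod A where
  X := A.X
  act h := A.mul h
  one_act a := A.one_mul a
  mul_act hij hjl h h' a b c := A.mul_assoc hij hjl h h' a b c

/-- The target of a homomorphism of graded algebras `f : A → B`, as a graded left `A`-module. -/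
def GrAlgHom.targetModule {A B : GrAlg R} (f : GrAlgHom A B) : GrMod A where
  X := B.X
  act h := (B.mul h).comp (f.app _)
  one_act b := by simp [f.map_one, B.one_mul]
  mul_act hij hjl h h' a b c := by
    simp only [LinearMap.comp_apply, f.map_mul]
    exact B.mul_assoc hij hjl h h' _ _ _

/-- A homomorphism of graded algebras `f : A → B`, as a homomorphism of graded left
`A`-modules. -/
def GrAlgHom.toGrHom {A B : GrAlg R} (f : GrAlgHom A B) : GrHom A.self f.targetModule where
  app := f.app
  map_act h a x := f.map_mul h a x

/-- The shift `Σ^s M`: one has `(Σ^s M)^n = M^(n+s)`, that is `(Σ^s M)_n = M_(n-s)` in lower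
degrees, and `a · σ^s(x) = (-1)^(|a|s) σ^s(a · x)`. -/
def GrMod.shift {A : GrAlg R} (s : ℤ) (M : GrMod A) : GrMod A where
  X n := M.X (n + s)
  act {i j n} h := (i * s).negOnePow • M.act (show i + (j + s) = n + s by omega)
  one_act {i} x := by
    simp only [zero_mul, Int.negOnePow_zero, _root_.one_smul]
    exact M.one_act x
  mul_act {i j l ij jl n} hij hjl h h' a b x := by
    subst hij
    simp only [LinearMap.smul_apply, Units.smul_def, map_zsmul, smul_smul]
    rw [M.mul_act rfl (show j + (l + s) = jl + s by omega) _
      (show i + (jl + s) = n + s by omega) a b x, add_mul, Int.negOnePow_add]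
    simp [mul_comm]

/-- The graded left module `Hom(A, V)`: in degree `n` it consists of the linear maps
`A^(-n) → V`, and the action is
`(a · φ)(b) = (-1)^(|a|(|φ|+|b|)) φ(b · a)`.  When `V` is the residue field `k` of a local ring `R`,
an `R`-linear map to `k` vanishes on the multiples of the maximal ideal, and so for a graded
`k`-algebra `A` this is the graded `k`-dual `Hom_k(A, k)`. -/
def GrAlg.dual (A : GrAlg R) (V : Type u) [AddCommGroup V] [Module R V] : GrMod A where
  X n := A.X (-n) →ₗ[R] V
  act {i j n} h := LinearMap.mk₂ R
    (fun a φ => (i * (j + -n)).negOnePow •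
      (φ ∘ₗ (A.mul (show -n + i = -j by omega)).flip a))
    (fun a a' φ => by ext b; simp [Units.smul_def])
    (fun r a φ => by ext b; simp [Units.smul_def, smul_comm r])
    (fun a φ φ' => by ext b; simp [Units.smul_def])
    (fun r a φ => by ext b; simp [Units.smul_def, smul_comm r])
  one_act {i} φ := by
    ext b
    have := A.mul_one b
    simp [this]
  mul_act {i j l ij jl n} hij hjl h h' a b φ := by
    ext c
    have hs : (ij * (l + -n)).negOnePow =
        (i * (jl + -n)).negOnePow * (j * (l + -jl)).negOnePow := by
      rw [← Int.negOnePow_add, Int.negOnePow_eq_iff]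
      have h1 : n = i + j + l := by omega
      subst h1 hij hjl
      exact ⟨-(i * j), by ring⟩
    have hm := A.mul_assoc (show -n + i = -jl by omega) hij
      (show -jl + j = -l by omega) (show -n + ij = -l by omega) c a b
    simp [Units.smul_def, hs, hm, mul_smul, smul_comm (((i * (jl + -n)).negOnePow : ℤˣ) : ℤ)]

/-- The coproduct (degreewise direct sum) of a family of graded left modules. -/
def GrMod.coprod {A : GrAlg R} {ι : Type} (M : ι → GrMod A) : GrMod A where
  X n := DirectSum ι fun c => (M c).X n
  act h := LinearMap.mk₂ R (fun a x => DirectSum.lmap (fun c => (M c).act h a) x)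
    (fun a a' x => by ext c; simp)
    (fun r a x => by ext c; simp [DirectSum.smul_apply])
    (fun a x x' => by simp)
    (fun r a x => by simp)
  one_act x := by
    ext c
    simpa using (M c).one_act (x c)
  mul_act hij hjl h h' a b x := by
    ext c
    simpa using (M c).mul_act hij hjl h h' a b (x c)

/-! ## Total rings and total modules -/

instance (A : GrAlg R) : GradedMonoid.GOne A.X where
  one := A.one

instance (A : GrAlg R) : GradedMonoid.GMul A.X where
  mul a b := A.mul rfl a b

instance (A : GrAlg R) : GradedMonoid.GMonoid A.X where
  one_mul := by
    rintro ⟨i, a⟩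
    have key : ∀ n (h : 0 + i = n), (⟨n, A.mul h A.one a⟩ : GradedMonoid A.X) = ⟨i, a⟩ := by
      intro n h
      obtain rfl : i = n := by omega
      rw [A.one_mul]
    exact key _ rfl
  mul_one := by
    rintro ⟨i, a⟩
    have key : ∀ n (h : i + 0 = n), (⟨n, A.mul h a A.one⟩ : GradedMonoid A.X) = ⟨i, a⟩ := by
      intro n h
      obtain rfl : i = n := by omega
      rw [A.mul_one]
    exact key _ rfl
  mul_assoc := by
    rintro ⟨i, a⟩ ⟨j, b⟩ ⟨l, c⟩
    have key : ∀ n n' (h : i + j + l = n) (h' : i + (j + l) = n'),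
        (⟨n, A.mul h (A.mul rfl a b) c⟩ : GradedMonoid A.X) =
          ⟨n', A.mul h' a (A.mul rfl b c)⟩ := by
      intro n n' h h'
      obtain rfl : n = n' := by omega
      rw [A.mul_assoc rfl rfl h h']
    exact key _ _ rfl rfl

instance (A : GrAlg R) : DirectSum.GRing A.X where
  mul_zero a := map_zero (A.mul rfl a)
  zero_mul b := LinearMap.map_zero₂ (A.mul rfl) b
  mul_add a b c := map_add (A.mul rfl a) b c
  add_mul a a' b := LinearMap.map_add₂ (A.mul rfl) a a' b
  natCast n := n • A.one
  natCast_zero := zero_smul ℕ _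
  natCast_succ n := by rw [succ_nsmul]; rfl
  intCast n := n • A.one
  intCast_ofNat n := natCast_zsmul _ n
  intCast_negSucc_ofNat n := negSucc_zsmul _ n

instance {A : GrAlg R} (M : GrMod A) : DirectSum.Gmodule A.X M.X where
  smul a x := M.act rfl a x
  smul_add a b c := map_add _ _ _
  smul_zero a := map_zero _
  add_smul a b c := by simp
  zero_smul b := by simp
  one_smul := by
    rintro ⟨i, x⟩
    have key : ∀ n (h : 0 + i = n), (⟨n, M.act h A.one x⟩ : GradedMonoid M.X) = ⟨i, x⟩ := by
      intro n h
      obtain rfl : i = n := by omega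
      rw [M.one_act]
    exact key _ rfl
  mul_smul := by
    rintro ⟨i, a⟩ ⟨j, b⟩ ⟨l, c⟩
    have key : ∀ n n' (h : i + j + l = n) (h' : i + (j + l) = n'),
        (⟨n, M.act h (A.mul rfl a b) c⟩ : GradedMonoid M.X) =
          ⟨n', M.act h' a (M.act rfl b c)⟩ := by
      intro n n' h h'
      obtain rfl : n = n' := by omega
      rw [M.mul_act rfl rfl h h']
    exact key _ _ rfl rfl

/-- The underlying (ungraded) ring `⨁ n, A^n` of a graded algebra. -/
abbrev GrAlg.Total (A : GrAlg R) : Type u := DirectSum ℤ A.X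

/-- The underlying (ungraded) left module `⨁ n, M^n` of a graded left module. -/
abbrev GrMod.Total {A : GrAlg R} (M : GrMod A) : Type u := DirectSum ℤ M.X

/-- The linear map of underlying modules defined by a homomorphism of graded modules. -/
def GrHom.total {A : GrAlg R} {M N : GrMod A} (f : GrHom M N) :
    M.Total →ₗ[A.Total] N.Total where
  toFun := DirectSum.map fun n => (f.app n).toAddMonoidHom
  map_add' := map_add _
  map_smul' a x := by
    simp only [RingHom.id_apply]
    induction a using DirectSum.induction_on with
    | zero => simp only [zero_smul, map_zero]
    | add a b ha hb => simp only [add_smul, map_add, ha, hb]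
    | of i a =>
      induction x using DirectSum.induction_on with
      | zero => simp only [smul_zero, map_zero]
      | add x y hx hy => simp only [smul_add, map_add, hx, hy]
      | of j x =>
        rw [DirectSum.Gmodule.of_smul_of, DirectSum.map_of, DirectSum.map_of,
          DirectSum.Gmodule.of_smul_of]
        exact congrArg _ (f.map_act rfl a x)

/-- The left ideal `A^{≥ 1}`, generated by the homogeneous elements of positive degree. -/
def GrAlg.posIdeal (A : GrAlg R) : Submodule A.Total A.Total :=
  Submodule.span A.Total
    {x : A.Total | ∃ (n : ℤ) (_ : 1 ≤ n) (a : A.X n), x = DirectSum.of A.X n a}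

/-- The left `A`-module `A / A^{≥ 1}`.  When `A^0 = k` is a field and `A^n = 0` for `n < 0`,
this is the field `k` on which `A` acts through the augmentation `A → k`. -/
abbrev GrAlg.Residue (A : GrAlg R) : Type u := A.Total ⧸ A.posIdeal

/-! ## Cohomology of endomorphism complexes

For a complex `F`, `Cochain F F n` is the module of homomorphisms `F → F` of upper degree `n`, and
`δ β = ∂ β - (-1)^n β ∂`. -/

section EndComplex

variable {F : CochainComplex (ModuleCat.{u} R) ℤ}

/-- The composition product `(α, β) ↦ α ∘ β` of the DG algebra `Hom(F, F)`.  (`Cochain.comp` takes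
the map that is applied first as its first argument.) -/
def cmul {i j n : ℤ} (h : i + j = n) :
    Cochain F F i →ₗ[R] Cochain F F j →ₗ[R] Cochain F F n :=
  LinearMap.mk₂ R
    (fun α β => β.comp α ((add_comm j i).trans h))
    (fun _ _ _ => Cochain.comp_add _ _ _ _)
    (fun _ _ _ => Cochain.comp_smul _ _ _ _)
    (fun _ _ _ => Cochain.add_comp _ _ _ _)
    (fun _ _ _ => Cochain.smul_comp _ _ _ _)

lemma cmul_assoc {i j l ij jl n : ℤ} (hij : i + j = ij) (hjl : j + l = jl)
    (h : ij + l = n) (h' : i + jl = n) (α : Cochain F F i) (β : Cochain F F j)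
    (γ : Cochain F F l) :
    cmul h (cmul hij α β) γ = cmul h' α (cmul hjl β γ) :=
  (Cochain.comp_assoc γ β α ((add_comm l j).trans hjl) ((add_comm j i).trans hij)
    (by omega)).symm

lemma one_cmul {i : ℤ} (α : Cochain F F i) :
    cmul (zero_add i) (Cochain.ofHom (𝟙 F)) α = α := Cochain.comp_id α

lemma cmul_one {i : ℤ} (α : Cochain F F i) :
    cmul (add_zero i) α (Cochain.ofHom (𝟙 F)) = α := Cochain.id_comp α

lemma δ_cmul {i j n : ℤ} (h : i + j = n) (i' j' n' : ℤ) (hi : i + 1 = i') (hj : j + 1 = j')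
    (hn : n + 1 = n') (α : Cochain F F i) (β : Cochain F F j) :
    δ n n' (cmul h α β) = cmul (show i' + j = n' by omega) (δ i i' α) β +
      i.negOnePow • cmul (show i + j' = n' by omega) α (δ j j' β) :=
  δ_comp β α ((add_comm j i).trans h) j' i' n' hn hj hi

/-- A two-sided DG ideal in the DG algebra `Hom(F, F)`. -/
structure DGIdeal (F : CochainComplex (ModuleCat.{u} R) ℤ) where
  /-- the component of degree `n` -/
  I : ∀ n : ℤ, Submodule R (Cochain F F n)
  δ_mem : ∀ {n m : ℤ} {β : Cochain F F n}, β ∈ I n → δ n m β ∈ I m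
  mul_left : ∀ {i j n : ℤ} (h : i + j = n) (α : Cochain F F i) {β : Cochain F F j},
    β ∈ I j → cmul h α β ∈ I n
  mul_right : ∀ {i j n : ℤ} (h : i + j = n) {α : Cochain F F i} (β : Cochain F F j),
    α ∈ I i → cmul h α β ∈ I n

variable (F)

/-- The zero ideal of `Hom(F, F)`. -/
def zeroIdeal : DGIdeal F where
  I _ := ⊥
  δ_mem h := by
    rw [Submodule.mem_bot] at h ⊢
    rw [h, δ_zero]
  mul_left {i j n} h α {β} hβ := by
    rw [Submodule.mem_bot] at hβ ⊢
    rw [hβ, map_zero]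
  mul_right {i j n} h {α} β hα := by
    rw [Submodule.mem_bot] at hα ⊢
    rw [hα, LinearMap.map_zero₂]

/-- The ideal of bounded homomorphisms: those `β` with `β_i = 0` for all `i ≫ 0`, where `β_i` is
the restriction of `β` to the component of lower degree `i`, that is, of upper degree `-i`. -/
def boundedIdeal : DGIdeal F where
  I n :=
    { carrier := {β | ∃ N : ℤ, ∀ (i q : ℤ) (h : -i + n = q), N ≤ i → β.v (-i) q h = 0}
      zero_mem' := ⟨0, fun _ _ _ _ => rfl⟩
      add_mem' := by
        rintro β γ ⟨N, hN⟩ ⟨N', hN'⟩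
        refine ⟨max N N', fun i q h hi => ?_⟩
        rw [Cochain.add_v, hN i q h (le_trans (le_max_left _ _) hi),
          hN' i q h (le_trans (le_max_right _ _) hi), add_zero]
      smul_mem' := by
        rintro r β ⟨N, hN⟩
        exact ⟨N, fun i q h hi => by rw [Cochain.smul_v, hN i q h hi, smul_zero]⟩ }
  δ_mem {n m β} := by
    rintro ⟨N, hN⟩
    by_cases hnm : n + 1 = m
    · refine ⟨N + 1, fun i q h hi => ?_⟩
      rw [δ_v n m hnm β (-i) q h (q - 1) (-(i - 1)) rfl (by omega),
        hN i (q - 1) (by omega) (by omega), hN (i - 1) q (by omega) (by omega)]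
      simp
    · rw [δ_shape n m hnm]
      exact ⟨0, fun _ _ _ _ => rfl⟩
  mul_left {i j n} h α {β} := by
    rintro ⟨N, hN⟩
    refine ⟨N, fun p q hp hi => ?_⟩
    change (β.comp α ((add_comm j i).trans h)).v (-p) q hp = 0
    rw [Cochain.comp_v β α ((add_comm j i).trans h) (-p) (-p + j) q rfl (by omega),
      hN p _ rfl hi]
    simp
  mul_right {i j n} h {α} β := by
    rintro ⟨N, hN⟩
    refine ⟨N + j, fun p q hp hi => ?_⟩
    change (β.comp α ((add_comm j i).trans h)).v (-p) q hp = 0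
    rw [Cochain.comp_v β α ((add_comm j i).trans h) (-p) (-(p - j)) q (by omega) (by omega),
      hN (p - j) q (by omega) (by omega)]
    simp

variable {F}

/-- The bilinear map of quotients induced by a bilinear map. -/
def quotMap₂ {M N P : Type u} [AddCommGroup M] [AddCommGroup N] [AddCommGroup P]
    [Module R M] [Module R N] [Module R P] (p : Submodule R M) (q : Submodule R N)
    (r : Submodule R P) (f : M →ₗ[R] N →ₗ[R] P)
    (hp : ∀ x ∈ p, ∀ y, f x y ∈ r) (hq : ∀ x, ∀ y ∈ q, f x y ∈ r) :
    (M ⧸ p) →ₗ[R] (N ⧸ q) →ₗ[R] (P ⧸ r) :=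
  p.liftQ
    { toFun := fun x => q.mapQ r (f x) (hq x)
      map_add' := fun x x' => by ext y; simp
      map_smul' := fun c x => by ext y; simp }
    (fun x hx => by
      rw [LinearMap.mem_ker]
      ext y
      simpa using hp x hx y)

namespace DGIdeal

variable (B : DGIdeal F)

/-- The preimage in `Hom(F, F)` of the cycles of degree `n` of `Hom(F, F) / B`. -/
def cyc (n : ℤ) : Submodule R (Cochain F F n) :=
  (B.I (n + 1)).comap (δ_hom R F F n (n + 1))

/-- The preimage in `Hom(F, F)` of the boundaries of degree `n` of `Hom(F, F) / B`. -/
def bdy (n : ℤ) : Submodule R (Cochain F F n) :=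
  LinearMap.range (δ_hom R F F (n - 1) n) ⊔ B.I n

/-- The cohomology `H^n(Hom(F, F) / B)`, with cycles and boundaries replaced by their preimages
in `Hom(F, F)`. -/
abbrev HQuot (n : ℤ) : Type u := B.cyc n ⧸ (B.bdy n).submoduleOf (B.cyc n)

lemma mem_cyc {n : ℤ} {β : Cochain F F n} : β ∈ B.cyc n ↔ δ n (n + 1) β ∈ B.I (n + 1) :=
  Iff.rfl

lemma δ_mem_bdy {m n : ℤ} (γ : Cochain F F m) : δ m n γ ∈ B.bdy n := by
  by_cases h : m + 1 = n
  · obtain rfl : m = n - 1 := by omega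
    exact Submodule.mem_sup_left ⟨γ, rfl⟩
  · rw [δ_shape m n h]; exact zero_mem _

lemma mem_bdy {n : ℤ} {β : Cochain F F n} :
    β ∈ B.bdy n ↔ ∃ γ : Cochain F F (n - 1), ∃ b ∈ B.I n, δ (n - 1) n γ + b = β := by
  simp only [bdy, Submodule.mem_sup, LinearMap.mem_range, exists_exists_eq_and]
  rfl

lemma negOnePow_smul_mem {n i : ℤ} {S : Submodule R (Cochain F F n)} {x : Cochain F F n}
    (hx : x ∈ S) : i.negOnePow • x ∈ S := by
  rw [Units.smul_def]; exact zsmul_mem hx _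

lemma cmul_mem_cyc {i j n : ℤ} (h : i + j = n) {α : Cochain F F i} {β : Cochain F F j}
    (hα : α ∈ B.cyc i) (hβ : β ∈ B.cyc j) : cmul h α β ∈ B.cyc n := by
  rw [mem_cyc, δ_cmul h (i + 1) (j + 1) (n + 1) rfl rfl rfl]
  exact add_mem (B.mul_right _ _ hα) (negOnePow_smul_mem (B.mul_left _ _ hβ))

lemma cmul_mem_bdy_left {i j n : ℤ} (h : i + j = n) {α : Cochain F F i} {β : Cochain F F j}
    (hα : α ∈ B.bdy i) (hβ : β ∈ B.cyc j) : cmul h α β ∈ B.bdy n := by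
  obtain ⟨γ, b, hb, rfl⟩ := B.mem_bdy.1 hα
  rw [LinearMap.map_add₂]
  refine add_mem ?_ (Submodule.mem_sup_right (B.mul_right _ _ hb))
  have h0 : (i - 1) + j = n - 1 := by omega
  rw [eq_sub_of_add_eq (δ_cmul h0 i (j + 1) n (by omega) rfl (by omega) γ β).symm]
  exact sub_mem (B.δ_mem_bdy _)
    (Submodule.mem_sup_right (negOnePow_smul_mem (B.mul_left _ _ hβ)))

lemma cmul_δ {i j n : ℤ} (h : i + j = n) (h0 : i + (j - 1) = n - 1) (h1 : i + 1 + (j - 1) = n)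
    (α : Cochain F F i) (γ : Cochain F F (j - 1)) :
    cmul h α (δ (j - 1) j γ) =
      i.negOnePow • (δ (n - 1) n (cmul h0 α γ) - cmul h1 (δ i (i + 1) α) γ) := by
  rw [δ_cmul h0 (i + 1) j n rfl (by omega) (by omega) α γ, add_sub_cancel_left, smul_smul,
    Int.units_mul_self, one_smul]

lemma cmul_mem_bdy_right {i j n : ℤ} (h : i + j = n) {α : Cochain F F i} {β : Cochain F F j}
    (hα : α ∈ B.cyc i) (hβ : β ∈ B.bdy j) : cmul h α β ∈ B.bdy n := by
  obtain ⟨γ, b, hb, rfl⟩ := B.mem_bdy.1 hβ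
  rw [map_add]
  refine add_mem ?_ (Submodule.mem_sup_right (B.mul_left _ _ hb))
  rw [cmul_δ h (by omega) (by omega)]
  exact negOnePow_smul_mem
    (sub_mem (B.δ_mem_bdy _) (Submodule.mem_sup_right (B.mul_right _ _ hα)))

/-- The product `(α, β) ↦ α ∘ β` on (preimages of) cycles. -/
def cycMul {i j n : ℤ} (h : i + j = n) : B.cyc i →ₗ[R] B.cyc j →ₗ[R] B.cyc n :=
  LinearMap.mk₂ R
    (fun α β => ⟨cmul h α.1 β.1, B.cmul_mem_cyc h α.2 β.2⟩)
    (fun _ _ _ => Subtype.ext (LinearMap.map_add₂ _ _ _ _))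
    (fun _ _ _ => Subtype.ext (LinearMap.map_smul₂ _ _ _ _))
    (fun _ _ _ => Subtype.ext (map_add _ _ _))
    (fun _ _ _ => Subtype.ext (map_smul _ _ _))

/-- The graded algebra `H(Hom(F, F) / B)`, with product induced by composition. -/
def cohomologyAlg : GrAlg R where
  X := B.HQuot
  mul {i j n} h := quotMap₂ _ _ _ (B.cycMul h)
    (fun _ hα β => B.cmul_mem_bdy_left h hα β.2)
    (fun α _ hβ => B.cmul_mem_bdy_right h α.2 hβ)
  one := Submodule.Quotient.mk ⟨Cochain.ofHom (𝟙 F), by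
    rw [mem_cyc, δ_ofHom]; exact zero_mem _⟩
  one_mul {i} a := by
    induction a using Submodule.Quotient.induction_on with
    | H a => exact congrArg Submodule.Quotient.mk (Subtype.ext (one_cmul a.1))
  mul_one {i} a := by
    induction a using Submodule.Quotient.induction_on with
    | H a => exact congrArg Submodule.Quotient.mk (Subtype.ext (cmul_one a.1))
  mul_assoc {i j l ij jl n} hij hjl h h' a b c := by
    induction a using Submodule.Quotient.induction_on with
    | H a =>
    induction b using Submodule.Quotient.induction_on with
    | H b =>
    induction c using Submodule.Quotient.induction_on with
    | H c =>
      exact congrArg Submodule.Quotient.mk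
        (Subtype.ext (cmul_assoc hij hjl h h' a.1 b.1 c.1))

/-- The cycles of degree `n` of the complex `B`. -/
def subCyc (n : ℤ) : Submodule R (Cochain F F n) :=
  B.I n ⊓ LinearMap.ker (δ_hom R F F n (n + 1))

/-- The boundaries of degree `n` of the complex `B`. -/
def subBdy (n : ℤ) : Submodule R (Cochain F F n) :=
  (B.I (n - 1)).map (δ_hom R F F (n - 1) n)

/-- The cohomology `H^n(B)`. -/
abbrev HSub (n : ℤ) : Type u := B.subCyc n ⧸ (B.subBdy n).submoduleOf (B.subCyc n)

lemma δ_mem_subBdy {m n : ℤ} {γ : Cochain F F m} (hγ : γ ∈ B.I m) :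
    δ m n γ ∈ B.subBdy n := by
  by_cases h : m + 1 = n
  · obtain rfl : m = n - 1 := by omega
    exact ⟨γ, hγ, rfl⟩
  · rw [δ_shape m n h]; exact zero_mem _

lemma δ_eq_zero_of_subCyc {n : ℤ} {β : Cochain F F n} (hβ : β ∈ B.subCyc n) :
    δ n (n + 1) β = 0 := hβ.2

lemma δ_eq_zero_of_cyc {n : ℤ} {β : Cochain F F n} (hβ : β ∈ (zeroIdeal F).cyc n) :
    δ n (n + 1) β = 0 := (Submodule.mem_bot R).1 hβ

lemma exists_δ_of_bdy {n : ℤ} {β : Cochain F F n} (hβ : β ∈ (zeroIdeal F).bdy n) :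
    ∃ γ : Cochain F F (n - 1), δ (n - 1) n γ = β := by
  obtain ⟨γ, b, hb, e⟩ := (zeroIdeal F).mem_bdy.1 hβ
  obtain rfl : b = 0 := (Submodule.mem_bot R).1 hb
  exact ⟨γ, by rw [← e, add_zero]⟩

lemma cmul_mem_subCyc {i j n : ℤ} (h : i + j = n) {α : Cochain F F i} {β : Cochain F F j}
    (hα : α ∈ (zeroIdeal F).cyc i) (hβ : β ∈ B.subCyc j) : cmul h α β ∈ B.subCyc n := by
  refine ⟨B.mul_left h α hβ.1, ?_⟩
  change δ n (n + 1) _ = 0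
  rw [δ_cmul h (i + 1) (j + 1) (n + 1) rfl rfl rfl, δ_eq_zero_of_cyc hα,
    LinearMap.map_zero₂,
    B.δ_eq_zero_of_subCyc hβ, map_zero, smul_zero, add_zero]

lemma cmul_mem_subBdy_left {i j n : ℤ} (h : i + j = n) {α : Cochain F F i}
    {β : Cochain F F j} (hα : α ∈ (zeroIdeal F).bdy i) (hβ : β ∈ B.subCyc j) :
    cmul h α β ∈ B.subBdy n := by
  obtain ⟨γ, rfl⟩ := exists_δ_of_bdy hα
  have h0 : (i - 1) + j = n - 1 := by omega
  have key := δ_cmul h0 i (j + 1) n (by omega) rfl (by omega) γ β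
  rw [B.δ_eq_zero_of_subCyc hβ, map_zero, smul_zero, add_zero] at key
  rw [← key]
  exact B.δ_mem_subBdy (B.mul_left _ _ hβ.1)

lemma cmul_mem_subBdy_right {i j n : ℤ} (h : i + j = n) {α : Cochain F F i}
    {β : Cochain F F j} (hα : α ∈ (zeroIdeal F).cyc i) (hβ : β ∈ B.subBdy j) :
    cmul h α β ∈ B.subBdy n := by
  obtain ⟨γ, hγ, rfl⟩ := hβ
  change cmul h α (δ (j - 1) j γ) ∈ _
  rw [cmul_δ h (by omega) (by omega), δ_eq_zero_of_cyc hα, LinearMap.map_zero₂, sub_zero]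
  exact negOnePow_smul_mem (B.δ_mem_subBdy (B.mul_left _ _ hγ))

/-- The action of cycles of `Hom(F, F)` on cycles of `B`: `(α, β) ↦ α ∘ β`. -/
def cycAct {i j n : ℤ} (h : i + j = n) :
    (zeroIdeal F).cyc i →ₗ[R] B.subCyc j →ₗ[R] B.subCyc n :=
  LinearMap.mk₂ R
    (fun α β => ⟨cmul h α.1 β.1, B.cmul_mem_subCyc h α.2 β.2⟩)
    (fun _ _ _ => Subtype.ext (LinearMap.map_add₂ _ _ _ _))
    (fun _ _ _ => Subtype.ext (LinearMap.map_smul₂ _ _ _ _))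
    (fun _ _ _ => Subtype.ext (map_add _ _ _))
    (fun _ _ _ => Subtype.ext (map_smul _ _ _))

/-- `H(B)` as a graded left module over `H(Hom(F, F))`, with action induced by composition. -/
def cohomologyMod : GrMod (zeroIdeal F).cohomologyAlg where
  X := B.HSub
  act {i j n} h := quotMap₂ _ _ _ (B.cycAct h)
    (fun _ hα β => B.cmul_mem_subBdy_left h hα β.2)
    (fun α _ hβ => B.cmul_mem_subBdy_right h α.2 hβ)
  one_act {i} a := by
    induction a using Submodule.Quotient.induction_on with
    | H a => exact congrArg Submodule.Quotient.mk (Subtype.ext (one_cmul a.1))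
  mul_act {i j l ij jl n} hij hjl h h' a b c := by
    induction a using Submodule.Quotient.induction_on with
    | H a =>
    induction b using Submodule.Quotient.induction_on with
    | H b =>
    induction c using Submodule.Quotient.induction_on with
    | H c =>
      exact congrArg Submodule.Quotient.mk
        (Subtype.ext (cmul_assoc hij hjl h h' a.1 b.1 c.1))

/-- The homomorphism `H(Hom(F, F)) → H(Hom(F, F) / B)` induced by the canonical projection. -/
def proj : GrAlgHom (zeroIdeal F).cohomologyAlg B.cohomologyAlg where
  app n := Submodule.mapQ _ _
    (Submodule.inclusion (show (zeroIdeal F).cyc n ≤ B.cyc n from fun β hβ => by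
      rw [mem_cyc, δ_eq_zero_of_cyc hβ]; exact zero_mem _))
    (fun β hβ => by
      obtain ⟨γ, e⟩ := exists_δ_of_bdy hβ
      exact B.mem_bdy.2 ⟨γ, 0, zero_mem _, (add_zero _).trans e⟩)
  map_one := rfl
  map_mul {i j n} h a b := by
    induction a using Submodule.Quotient.induction_on with
    | H a =>
    induction b using Submodule.Quotient.induction_on with
    | H b => exact congrArg Submodule.Quotient.mk (Subtype.ext rfl)

/-- The connecting homomorphism `H(Hom(F, F) / B) → Σ H(B)`, `[β] ↦ [δ β]`, of graded left
modules over `H(Hom(F, F))`. -/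
def connecting : GrHom B.proj.targetModule (B.cohomologyMod.shift 1) where
  app n := Submodule.mapQ _ _
    (LinearMap.codRestrict (B.subCyc (n + 1)) ((δ_hom R F F n (n + 1)) ∘ₗ (B.cyc n).subtype)
      (fun β => ⟨β.2, δ_δ n (n + 1) (n + 1 + 1) β.1⟩))
    (fun β hβ => by
      obtain ⟨γ, b, hb, e⟩ := B.mem_bdy.1 hβ
      change δ n (n + 1) ((B.cyc n).subtype β) ∈ B.subBdy (n + 1)
      rw [← e, δ_add, δ_δ, zero_add]
      exact B.δ_mem_subBdy hb)
  map_act {i j n} h a b := by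
    induction a using Submodule.Quotient.induction_on with
    | H a =>
    induction b using Submodule.Quotient.induction_on with
    | H b =>
      have key := δ_cmul h (i + 1) (j + 1) (n + 1) rfl rfl rfl a.1 b.1
      rw [δ_eq_zero_of_cyc a.2, LinearMap.map_zero₂, zero_add] at key
      have h1 : (i * 1).negOnePow = i.negOnePow := by rw [mul_one]
      change _ = (i * 1).negOnePow • (Submodule.Quotient.mk _ : B.HSub (n + 1))
      rw [h1]
      exact congrArg Submodule.Quotient.mk (Subtype.ext key)

end DGIdeal

end EndComplex

/-! ## Absolute, bounded and stable cohomology of a module -/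

section Cohomology

variable {M : ModuleCat.{u} R} (P : ProjectiveResolution M)

/-- The absolute cohomology algebra `Ext_R(M, M) = H(Hom(F, F))`, computed from a projective
resolution `F` of `M`. -/
noncomputable abbrev extAlg : GrAlg R := (zeroIdeal P.cochainComplex).cohomologyAlg

/-- The stable cohomology algebra of `M`: the cohomology of the quotient of `Hom(F, F)` by the
bounded homomorphisms. -/
noncomputable abbrev stableExtAlg : GrAlg R := (boundedIdeal P.cochainComplex).cohomologyAlg

/-- The bounded cohomology of `M`, as a graded left module over `Ext_R(M, M)`. -/
noncomputable abbrev boundedExt : GrMod (extAlg P) := (boundedIdeal P.cochainComplex).cohomologyMod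

/-- The canonical homomorphism `ι` from absolute to stable cohomology. -/
noncomputable abbrev iotaAlg : GrAlgHom (extAlg P) (stableExtAlg P) := (boundedIdeal P.cochainComplex).proj

/-- The stable cohomology of `M`, as a graded left module over `Ext_R(M, M)` via `ι`. -/
noncomputable abbrev stableExt : GrMod (extAlg P) := (iotaAlg P).targetModule

/-- The canonical homomorphism `ι`, as a homomorphism of graded left `Ext_R(M, M)`-modules. -/
noncomputable abbrev iota : GrHom (extAlg P).self (stableExt P) := (iotaAlg P).toGrHom

/-- The connecting homomorphism `ð` from stable cohomology to the shift of bounded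
cohomology. -/
noncomputable abbrev eth : GrHom (stableExt P) ((boundedExt P).shift 1) :=
  (boundedIdeal P.cochainComplex).connecting

end Cohomology

/-- The graded left module `(Σ I)^e ⊕ ∐_{i ≥ 0} (Σ^{-i} I)^{e^i (e^2 - 1)}`. -/
def shiftSum {A : GrAlg R} (I : GrMod A) (e : ℕ) : GrMod A :=
  GrMod.coprod (ι := Fin e ⊕ (Σ i : ℕ, Fin (e ^ i * (e ^ 2 - 1))))
    (Sum.elim (fun _ => I.shift 1) (fun p => I.shift (-(p.1 : ℤ))))

end StableExt

/-! Since 𝔪² = 0, the minimal resolution `G` of `k` has in homological degree `p` a basis of words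
of length `p` in `e` letters. Its differential strips the last letter and multiplies by the matching
generator of 𝔪. Removing the first letter acts at the other end of the word, so up to sign it
commutes with the differential and gives classes `t_i` of degree 1 in 𝓔. A nonempty word is its
first letter followed by its tail, and this has two consequences.

(a) All maps from `G` to `k` kill the differential, so 𝓔 is the space of cochains from `G` to `k`.
Splitting off the first letter shows that 𝓔^{≥1} is a free left module on the `t_i`, that is, 𝓔 is a
free algebra (`Comparison.isFreeOn`).

(b) Acting by `t_i` on a class is postcomposition with removal of the letter `i`. The resulting map
from `G_p` to `e` copies of `G_{p-1}` is bijective for `p ≥ 1`. Only `G_0` is lost, and cochains of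
a fixed degree with values in `G_0` are bounded. Hence `x ↦ (t_i x)_i` is a bijection from 𝓢^n to
`e` copies of 𝓢^{n+1} (`Comparison.bijective_leftMul`).

A bounded cocycle is killed by everything of large degree in 𝓔, and a free algebra has no such
nonzero element. So 𝓑 → 𝓔 is zero, and 0 → 𝓔 → 𝓢 → Σ𝓑 → 0 is exact
(`Comparison.isInvertingExtension`). The rest is formal.

1. Σ𝓑 is locally nilpotent and `x ↦ (t_i x)_i` is surjective on it, so it is cofree on its socle
(`SocleDual.bijective_hom`). By the snake lemma the socle in degree `n` is the cokernel of 𝓔^n →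
(𝓔^{n+1})^e. Its length is `e` for `n = -1`, `e^n(e^2-1)` for `n ≥ 0`, and zero otherwise.

2. Some nonzero `x` in 𝓢^{-1} has all `t_i x` in ι(𝓔). Its component in a complement would be killed
by all `t_i`, hence zero, while 𝓔^{-1} = 0.

3. Applying Hom(-, 𝓢) to the free resolution 0 → 𝓔^e → 𝓔 → k → 0 gives the bijection of (b), so
every Ext vanishes. -/

namespace StableExt

/-! ## Modules over a free graded algebra -/

section FreeAlgebra

variable {R : Type u} [CommRing R] {A : GrAlg R} {e : ℕ}

/-- The linear map `x ↦ (t_i x)_i` given by elements `t_i` of degree `1`. -/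
def GrMod.leftMul (M : GrMod A) (t : Fin e → A.X 1) (n : ℤ) :
    M.X n →ₗ[R] (Fin e → M.X (n + 1)) :=
  LinearMap.pi fun i => M.act (add_comm 1 n) (t i)

@[simp] lemma GrMod.leftMul_apply (M : GrMod A) (t : Fin e → A.X 1) (n : ℤ) (x : M.X n)
    (i : Fin e) : M.leftMul t n x i = M.act (add_comm 1 n) (t i) x := rfl

/-- The linear map `(a_i)_i ↦ ∑ a_i t_i` given by elements `t_i` of degree `1`. -/
def GrAlg.rightMul (A : GrAlg R) (t : Fin e → A.X 1) (n : ℤ) :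
    (Fin e → A.X n) →ₗ[R] A.X (n + 1) :=
  ∑ i, ((A.mul rfl).flip (t i)) ∘ₗ LinearMap.proj i

lemma GrAlg.rightMul_apply (A : GrAlg R) (t : Fin e → A.X 1) (n : ℤ) (a : Fin e → A.X n) :
    A.rightMul t n a = ∑ i, A.mul rfl (a i) (t i) := by
  simp [GrAlg.rightMul]

/-- `A` is the free algebra over the residue field of `R` on elements `t_i` of degree `1`: it is
concentrated in nonnegative degrees, `A^0` is the residue field, and `A^(≥ 1)` is free as a left
module on the `t_i`. -/
structure IsFreeOn [IsLocalRing R] (A : GrAlg R) (t : Fin e → A.X 1) : Prop where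
  neg : ∀ n < 0, Subsingleton (A.X n)
  exists_smul_one : ∀ a : A.X 0, ∃ r : R, a = r • A.one
  smul_one : ∀ r : R, r • A.one = 0 ↔ r ∈ IsLocalRing.maximalIdeal R
  bijective : ∀ n, 0 ≤ n → Function.Bijective (A.rightMul t n)

variable [IsLocalRing R] {t : Fin e → A.X 1}

local notation "k" => IsLocalRing.ResidueField R

lemma IsFreeOn.one_ne_zero (hA : IsFreeOn A t) : A.one ≠ 0 := fun h => by
  have := (hA.smul_one 1).1 (by rw [h, smul_zero])
  exact (IsLocalRing.maximalIdeal.isMaximal R).ne_top ((Ideal.eq_top_iff_one _).2 this)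

lemma IsFreeOn.exists_rightMul (hA : IsFreeOn A t) {n m : ℤ} (hn : 0 ≤ n) (h : n + 1 = m)
    (b : A.X m) : ∃ a : Fin e → A.X n, b = ∑ i, A.mul h (a i) (t i) := by
  subst h
  obtain ⟨a, rfl⟩ := (hA.bijective n hn).2 b
  exact ⟨a, A.rightMul_apply t n a⟩

/-- A module over an algebra whose unit is killed by the maximal ideal is killed by it. -/
lemma IsFreeOn.smul_eq_zero (hA : IsFreeOn A t) (M : GrMod A) {n : ℤ} (x : M.X n) {r : R}
    (hr : r ∈ IsLocalRing.maximalIdeal R) : r • x = 0 := by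
  rw [← M.one_act x, ← LinearMap.map_smul₂, (hA.smul_one r).2 hr, LinearMap.map_zero₂]

/-- A free algebra on a nonempty set of generators has no elements killed by all generators. -/
lemma IsFreeOn.leftMul_injective (hA : IsFreeOn A t) (he : 0 < e) (n : ℤ) :
    Function.Injective (A.self.leftMul t n) := by
  rcases lt_or_ge n 0 with hn | hn
  · have := hA.neg n hn
    exact fun x y _ => Subsingleton.elim (α := A.X n) x y
  rw [injective_iff_map_eq_zero]
  obtain ⟨m, rfl⟩ := Int.eq_ofNat_of_zero_le hn
  clear hn
  induction m with
  | zero =>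
    intro a ha
    obtain ⟨r, rfl⟩ := hA.exists_smul_one (a : A.X 0)
    have h0 := congrFun ha ⟨0, he⟩
    -- A scalar multiple of the unit is central, so `t_0 (r · 1) = 0` is also a relation among the
    -- right multiples of the `t_i`, which are independent.
    have h1 : A.rightMul t 0 (Pi.single ⟨0, he⟩ (r • A.one)) = 0 := by
      rw [GrAlg.rightMul_apply, Finset.sum_eq_single ⟨0, he⟩]
      · rw [Pi.single_eq_same, LinearMap.map_smul₂, A.one_mul]
        change A.mul (add_comm 1 0) (t ⟨0, he⟩) (r • A.one) = 0 at h0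
        rwa [map_smul, A.mul_one] at h0
      · intro j _ hj
        rw [Pi.single_eq_of_ne hj, LinearMap.map_zero₂]
      · simp
    have h2 := (hA.bijective 0 le_rfl).1 (h1.trans (map_zero _).symm)
    have h3 := congrFun h2 ⟨0, he⟩
    rw [Pi.single_eq_same] at h3
    exact h3
  | succ m ih =>
    intro a ha
    obtain ⟨b, rfl⟩ := hA.exists_rightMul (Int.natCast_nonneg m)
      (show (m : ℤ) + 1 = ((m + 1 : ℕ) : ℤ) by push_cast; rfl) a
    -- With `a = ∑ b_j t_j` one has `t_i a = ∑ (t_i b_j) t_j`, so freeness on the right gives `t_i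
    -- b_j = 0` for all `i`, and induction applies to each `b_j`.
    have hb : ∀ j, b j = 0 := by
      intro j
      refine ih (b j) (funext fun i => ?_)
      have h1 : A.rightMul t ((m : ℤ) + 1) (fun j => A.mul (add_comm 1 _) (t i) (b j)) = 0 := by
        rw [GrAlg.rightMul_apply]
        have h2 := congrFun ha i
        change A.mul _ (t i) (∑ j, A.mul _ (b j) (t j)) = 0 at h2
        rw [map_sum] at h2
        have h3 : ∀ n (h : (1 : ℤ) + ((m + 1 : ℕ) : ℤ) = n) (h' : (m : ℤ) + 1 + 1 = n),
            ∑ j, A.mul h (t i) (A.mul (by push_cast; rfl) (b j) (t j)) = 0 →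
            ∑ j, A.mul h' (A.mul (add_comm 1 (m : ℤ)) (t i) (b j)) (t j) = 0 := by
          intro n h h' hh
          rw [← hh]
          exact Finset.sum_congr rfl fun j _ => A.mul_assoc _ _ _ _ _ _ _
        obtain h4 : ((m + 1 : ℕ) : ℤ) + 1 = (m : ℤ) + 1 + 1 := by push_cast; rfl
        refine h3 _ (by push_cast; ring) rfl ?_
        revert h2
        generalize_proofs p1 p2 p3
        revert p1 p2 p3
        rw [h4]
        exact fun _ _ _ h => h
      have := (hA.bijective _ (by positivity)).1 (h1.trans (map_zero _).symm)
      exact congrFun this j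
    exact Finset.sum_eq_zero fun i _ => (congrArg (fun z => A.mul _ z (t i)) (hb i)).trans
      (LinearMap.map_zero₂ _ _)

end FreeAlgebra

/-! ## Cofree modules -/

section Cofree

variable {R : Type u} [CommRing R] {A : GrAlg R} {e : ℕ}

/-- A linear map to the degreewise direct sum, given by linear maps to the summands which on every
element vanish for almost all summands. -/
noncomputable def toDirectSum {ι : Type} {M : Type u} [AddCommGroup M] [Module R M]
    {N : ι → Type u} [∀ i, AddCommGroup (N i)] [∀ i, Module R (N i)] (f : ∀ i, M →ₗ[R] N i)
    (hf : ∀ x, {i | f i x ≠ 0}.Finite) : M →ₗ[R] DirectSum ι N :=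
  by
  classical
  exact
  { toFun := fun x => DFinsupp.mk (hf x).toFinset fun i => f i x
    map_add' := fun x y => by
      ext i
      simp only [DirectSum.add_apply]
      simp only [DFinsupp.mk_apply, Set.Finite.mem_toFinset, Set.mem_ofPred_eq]
      split_ifs <;> simp_all
    map_smul' := fun r x => by
      ext i
      simp only [DirectSum.smul_apply, RingHom.id_apply]
      simp only [DFinsupp.mk_apply, Set.Finite.mem_toFinset, Set.mem_ofPred_eq]
      split_ifs <;> simp_all }

@[simp] lemma toDirectSum_apply {ι : Type} {M : Type u} [AddCommGroup M] [Module R M]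
    {N : ι → Type u} [∀ i, AddCommGroup (N i)] [∀ i, Module R (N i)] (f : ∀ i, M →ₗ[R] N i)
    (hf : ∀ x, {i | f i x ≠ 0}.Finite) (x : M) (i : ι) : toDirectSum f hf x i = f i x := by
  classical
  simp only [toDirectSum, LinearMap.coe_mk, AddHom.coe_mk]
  simp only [DFinsupp.mk_apply, Set.Finite.mem_toFinset, Set.mem_ofPred_eq]
  split_ifs <;> simp_all

variable [IsLocalRing R] {t : Fin e → A.X 1}

local notation "k" => IsLocalRing.ResidueField R

/-- Every element of `C` is killed by all elements of `A` of large degree. -/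
def GrMod.LocallyNilpotent (C : GrMod A) : Prop :=
  ∀ (n : ℤ) (x : C.X n), ∃ N : ℕ, ∀ (i m : ℤ) (h : i + n = m), (N : ℤ) ≤ i →
    ∀ a : A.X i, C.act h a x = 0

/-- A system of linear functionals on a graded module, indexed by `ι`, the one with index `c` being
defined in degree `-(s c)`. -/
structure SocleDual (C : GrMod A) (t : Fin e → A.X 1) {ι : Type} (s : ι → ℤ) where
  /-- the functionals -/
  toFun : ∀ (c : ι) (n : ℤ), n + s c = 0 → (C.X n →ₗ[R] k)
  finite : ∀ n, {c | n + s c = 0}.Finite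
  eq_zero : ∀ n (x : C.X n), C.leftMul t n x = 0 → (∀ c h, toFun c n h x = 0) → x = 0
  exists_dual : ∀ c n h, ∃ x : C.X n, C.leftMul t n x = 0 ∧ toFun c n h x = 1 ∧
    ∀ c' h', c' ≠ c → toFun c' n h' x = 0

namespace SocleDual

variable {C : GrMod A} {ι : Type} {s : ι → ℤ} (l : SocleDual C t s)

/-- The map of degree `n` from `C` to the shifted dual of `A` defined by a functional. -/
noncomputable def component (c : ι) (n : ℤ) : C.X n →ₗ[R] (A.X (-(n + s c)) →ₗ[R] k) :=
  (n * (s c + 1)).negOnePow •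
    (((C.act (show -(n + s c) + n = -(s c) by omega)).flip).compr₂
      (l.toFun c (-(s c)) (by omega)))

lemma component_apply (c : ι) (n : ℤ) (x : C.X n) (b : A.X (-(n + s c))) :
    l.component c n x b = (n * (s c + 1)).negOnePow •
      l.toFun c (-(s c)) (by omega) (C.act (show -(n + s c) + n = -(s c) by omega) b x) := rfl

/-- Local nilpotence at `x` bounds `-(n + s c)` from above and the vanishing of `A` in negative
degrees bounds it from below. Each of the finitely many remaining degrees carries finitely many
functionals. -/
lemma finite_component (hA : IsFreeOn A t) (hC : C.LocallyNilpotent) (n : ℤ) (x : C.X n) :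
    {c | l.component c n x ≠ 0}.Finite := by
  obtain ⟨N, hN⟩ := hC n x
  refine Set.Finite.subset (Set.Finite.biUnion (Set.finite_Ico (-n - N) (-n + 1))
    fun m _ => l.finite (-m)) fun c hc => ?_
  simp only [Set.mem_iUnion, Set.mem_ofPred_eq, Set.mem_Ico]
  refine ⟨s c, ⟨?_, ?_⟩, by omega⟩
  · by_contra! h
    refine hc (LinearMap.ext fun b => ?_)
    rw [component_apply, hN _ _ _ (by omega), map_zero, smul_zero, LinearMap.zero_apply]
  · by_contra! h
    have := hA.neg (-(n + s c)) (by omega)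
    exact hc (LinearMap.ext fun b => by rw [Subsingleton.elim b 0, map_zero, map_zero])

/-- The homomorphism from a locally nilpotent module to a cofree module defined by functionals. -/
noncomputable def hom (hA : IsFreeOn A t) (hC : C.LocallyNilpotent) :
    GrHom C (GrMod.coprod fun c => (A.dual k).shift (s c)) where
  app n := toDirectSum (fun c => l.component c n) (l.finite_component hA hC n)
  map_act {i j n} h a x := by
    refine DFinsupp.ext fun c => ?_
    change (toDirectSum (fun c => l.component c n) (l.finite_component hA hC n)) _ c = _
    rw [toDirectSum_apply]
    change _ = (i * s c).negOnePow • ((A.dual k).act _ a)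
      ((toDirectSum (fun c => l.component c j) (l.finite_component hA hC j)) x c)
    rw [toDirectSum_apply]
    refine LinearMap.ext fun b => ?_
    change _ = (i * s c).negOnePow • (i * (j + s c + -(n + s c))).negOnePow •
      l.component c j x (A.mul _ b a)
    rw [component_apply, component_apply, smul_smul, smul_smul, ← Int.negOnePow_add,
      ← Int.negOnePow_add, C.mul_act _ h _ (by omega)]
    congr 1
    -- The sign in `component` is chosen so that, after the signs of the shift and of the dual, the
    -- remaining exponent is `i(i+1)`.
    rw [Int.negOnePow_eq_iff]
    subst h
    rw [show (i + j) * (s c + 1) - (i * s c + i * (j + s c + -(i + j + s c)) + j * (s c + 1))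
      = i * (i + 1) by ring]
    exact Int.even_mul_succ_self i

lemma hom_app_apply (hA : IsFreeOn A t) (hC : C.LocallyNilpotent) (n : ℤ) (x : C.X n) (c : ι) :
    DFinsupp.toFun ((l.hom hA hC).app n x) c = l.component c n x :=
  toDirectSum_apply _ _ _ _

/-- This gives injectivity. By induction on the nilpotency bound every `t_i x` vanishes, so `x` lies
in the socle, where the functionals separate points. -/
lemma eq_zero_of_act (N : ℕ) : ∀ (n : ℤ) (x : C.X n),
    (∀ (i m : ℤ) (h : i + n = m), (N : ℤ) ≤ i → ∀ a : A.X i, C.act h a x = 0) →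
    (∀ c i m (h : i + n = m) (h' : m + s c = 0) (b : A.X i), l.toFun c m h' (C.act h b x) = 0) →
    x = 0 := by
  induction N with
  | zero =>
    intro n x hx _
    rw [← C.one_act x]
    exact hx _ _ _ le_rfl _
  | succ N ih =>
    intro n x hx hl
    refine l.eq_zero n x (funext fun i => ih (n + 1) _ (fun j m h hj a => ?_)
      (fun c j m h h' b => ?_)) fun c h => ?_
    · rw [GrMod.leftMul_apply, ← C.mul_act (ij := j + 1) rfl _ (by omega) h]
      exact hx _ _ _ (by push_cast; omega) _
    · rw [GrMod.leftMul_apply, ← C.mul_act (ij := j + 1) rfl _ (by omega) h]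
      exact hl _ _ _ _ _ _
    · rw [← C.one_act x]
      exact hl _ _ _ _ _ _

/-- This gives surjectivity. Induction realizes the functionals `b ↦ φ (b t_j)` by elements `y_j`,
and surjectivity of `leftMul` supplies a common `x₀` with `t_j x₀ = y_j`. What remains is to correct
the values at the unit. -/
lemma exists_act_eq (hA : IsFreeOn A t) (hsurj : ∀ n, Function.Surjective (C.leftMul t n))
    (N : ℕ) : ∀ (n : ℤ) (φ : ∀ (c : ι) (i : ℤ), i + n + s c = 0 → (A.X i →ₗ[R] k)),
    (∀ c i h, (N : ℤ) ≤ i → φ c i h = 0) →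
    ∃ x : C.X n, ∀ c i h m (h' : i + n = m) (b : A.X i),
      l.toFun c m (h' ▸ h) (C.act h' b x) = φ c i h b := by
  induction N with
  | zero =>
    intro n φ hφ
    refine ⟨0, fun c i h m h' b => ?_⟩
    rw [map_zero, map_zero]
    rcases lt_or_ge i 0 with hi | hi
    · have := hA.neg i hi
      rw [Subsingleton.elim b 0, map_zero]
    · rw [hφ c i h (by simpa using hi), LinearMap.zero_apply]
  | succ N ih =>
    intro n φ hφ
    have h1 : ∀ j : Fin e, ∃ x : C.X (n + 1), ∀ c i (h : i + (n + 1) + s c = 0) m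
      (h' : i + (n + 1) = m) (b : A.X i),
      l.toFun c m (h' ▸ h) (C.act h' b x) =
        φ c (i + 1) (by omega) (A.mul rfl b (t j)) := fun j =>
      ih (n + 1) (fun c i h => (φ c (i + 1) (by omega)).comp ((A.mul rfl).flip (t j)))
        (fun c i h hi => by
          rw [hφ c (i + 1) _ (by push_cast; omega), LinearMap.zero_comp])
    choose y hy using h1
    obtain ⟨x₀, hx₀⟩ := hsurj n y
    have hx₀' : ∀ j, C.act (add_comm 1 n) (t j) x₀ = y j := fun j => congrFun hx₀ j
    choose! κ hκ0 hκ1 hκ using fun c => l.exists_dual c n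
    have hres : ∀ a : k, ∃ r : R, r • (1 : k) = a := fun a => by
      obtain ⟨r, rfl⟩ := IsLocalRing.residue_surjective a
      exact ⟨r, by rw [Algebra.smul_def, mul_one]; rfl⟩
    choose lift hlift using hres
    have hv : ∀ c, n + s c = 0 → ∃ a : k, ∀ h, a = φ c 0 h A.one - l.toFun c n (by omega) x₀ :=
      fun c h => ⟨φ c 0 (by omega) A.one - l.toFun c n h x₀, fun _ => rfl⟩
    choose! v hv using hv
    -- The correction lies in the socle, so it leaves the products with elements of positive degree
    -- unchanged and only adjusts the values at the unit.
    refine ⟨x₀ + ∑ c ∈ (l.finite n).toFinset, lift (v c) • κ c, fun c i h m h' b => ?_⟩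
    rcases lt_trichotomy i 0 with hi | rfl | hi
    · have := hA.neg i hi
      rw [Subsingleton.elim b 0, LinearMap.map_zero₂, map_zero, map_zero]
    · obtain ⟨r, rfl⟩ := hA.exists_smul_one b
      obtain rfl : n = m := by omega
      have hc : n + s c = 0 := by omega
      rw [LinearMap.map_smul₂, C.one_act, map_smul, map_smul, map_add, map_sum,
        Finset.sum_eq_single c]
      · rw [map_smul, hκ1 c hc, hv c hc h, hlift, add_sub_cancel]
      · intro c' hc' hne
        rw [map_smul, hκ c' (by simpa using hc') c _ hne.symm, smul_zero]
      · intro hc'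
        exact absurd (by simpa using hc) hc'
    · obtain ⟨b, rfl⟩ := hA.exists_rightMul (show 0 ≤ i - 1 by omega)
        (show i - 1 + 1 = i by omega) b
      have key : ∀ (j : Fin e) (z : C.X n), C.act h' (A.mul (by omega) (b j) (t j)) z =
          C.act (by omega) (b j) (C.act (add_comm 1 n) (t j) z) := fun j z =>
        C.mul_act _ _ _ _ _ _ _
      rw [map_sum, LinearMap.sum_apply, map_sum, map_sum]
      refine Finset.sum_congr rfl fun j _ => ?_
      rw [key, map_add, hx₀', map_sum, Finset.sum_eq_zero, add_zero, hy j c (i - 1) (by omega)]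
      · have : ∀ i' (hi : i' = i) (h1 : i - 1 + 1 = i') (h2 : i' + n + s c = 0),
            φ c i' h2 (A.mul h1 (b j) (t j)) = φ c i h (A.mul (by omega) (b j) (t j)) := by
          rintro _ rfl _ _; rfl
        exact this _ (by omega) _ _
      · intro c' hc'
        rw [map_smul]
        have : C.act (add_comm 1 n) (t j) (κ c') = 0 :=
          congrFun (hκ0 c' (by simpa using hc')) j
        rw [this, smul_zero]

lemma bijective_hom (hA : IsFreeOn A t) (hC : C.LocallyNilpotent)
    (hsurj : ∀ n, Function.Surjective (C.leftMul t n)) (n : ℤ) :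
    Function.Bijective ((l.hom hA hC).app n) := by
  constructor
  · rw [injective_iff_map_eq_zero]
    intro x hx
    obtain ⟨N, hN⟩ := hC n x
    refine l.eq_zero_of_act N n x hN fun c i m h h' b => ?_
    obtain rfl : i = -(n + s c) := by omega
    obtain rfl : m = -(s c) := by omega
    have h1 := l.hom_app_apply hA hC n x c
    rw [hx] at h1
    have h2 := l.component_apply c n x b
    rw [← h1] at h2
    exact ((smul_eq_zero_iff_eq _).1 h2.symm)
  · intro y
    classical
    -- Finite support of `y` bounds the degrees involved, as `exists_act_eq` needs. This is where
    -- the direct sum, rather than the product, matters.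
    have hN : ∃ N : ℕ, ∀ c ∈ DFinsupp.support y, -(n + s c) < N := by
      refine ⟨∑ c ∈ DFinsupp.support y, ((-(n + s c)).natAbs + 1), fun c hc => ?_⟩
      have := Finset.single_le_sum (f := fun c => ((-(n + s c)).natAbs + 1))
        (fun _ _ => Nat.zero_le _) hc
      simp only at this
      omega
    obtain ⟨N, hN⟩ := hN
    obtain ⟨x, hx⟩ := l.exists_act_eq hA hsurj N n
      (fun c i h => (n * (s c + 1)).negOnePow •
        ((show -(n + s c) = i by omega) ▸ (DFinsupp.toFun y c : A.X (-(n + s c)) →ₗ[R] k)))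
      (fun c i h hi => by
        have hy : DFinsupp.toFun y c = 0 := by
          by_contra hc
          have := hN c (DFinsupp.mem_support_iff.2 hc)
          omega
        obtain rfl : -(n + s c) = i := by omega
        change _ • (DFinsupp.toFun y c : A.X (-(n + s c)) →ₗ[R] k) = 0
        rw [hy]
        exact smul_zero _)
    refine ⟨x, DFinsupp.ext fun c =>
      (l.hom_app_apply hA hC n x c).trans (LinearMap.ext fun b => ?_)⟩
    rw [component_apply, hx c (-(n + s c)) (by omega) (-(s c)) (by omega) b, LinearMap.smul_apply,
      smul_smul, Int.units_mul_self, one_smul]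
    rfl

end SocleDual

end Cofree

/-! ## Extensions of locally nilpotent modules by free algebras -/

section Extension

variable {R : Type u} [CommRing R]

lemma GrHom.app_leftMul {A : GrAlg R} {e : ℕ} {t : Fin e → A.X 1} {M N : GrMod A}
    (f : GrHom M N) (n : ℤ) (x : M.X n) (i : Fin e) :
    f.app (n + 1) (M.leftMul t n x i) = N.leftMul t n (f.app n x) i := f.map_act _ _ _

variable [IsLocalRing R]

local notation "k" => IsLocalRing.ResidueField R

/-- A submodule of finite length of a module killed by the maximal ideal is identified by a
linear map on the whole module with a finite power of the residue field. -/
lemma exists_bijective_domRestrict {M : Type u} [AddCommGroup M] [Module R M]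
    (hM : ∀ r ∈ IsLocalRing.maximalIdeal R, ∀ x : M, r • x = 0) (K : Submodule R M) (d : ℕ)
    (hK : Module.length R K = d) :
    ∃ L : M →ₗ[R] (Fin d → k), Function.Bijective (L.domRestrict K) := by
  have hM' : Module.IsTorsionBySet R M (IsLocalRing.maximalIdeal R : Set R) :=
    fun x r => hM r r.2 x
  let _ : Module k M := hM'.module
  have : IsScalarTower R k M := hM'.isScalarTower
  have hsurj : Function.Surjective (algebraMap R k) := IsLocalRing.residue_surjective
  let K' : Submodule k M :=
    { K with
      smul_mem' := fun c x hx => by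
        obtain ⟨r, rfl⟩ := hsurj c
        rw [algebraMap_smul]
        exact K.smul_mem r hx }
  have hK' : Module.length k K' = d := by
    rw [← Module.length_eq_of_surjective hsurj, ← hK]
    exact LinearEquiv.length_eq (R := R) (M := K') (N := K)
      { Equiv.refl _ with
        map_add' := fun _ _ => rfl
        map_smul' := fun _ _ => rfl }
  have hfin : Module.Finite k K' := by
    rw [Module.length_eq_rank] at hK'
    rw [← Module.rank_lt_aleph0_iff]
    by_contra! h
    have := Cardinal.toENat_eq_top.2 h
    rw [this] at hK'
    exact ENat.top_ne_natCast _ hK'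
  have hd : Module.finrank k K' = d := by
    rw [Module.length_eq_finrank] at hK'
    exact_mod_cast hK'
  -- Over the residue field the subspace is a direct summand, so its coordinates extend to the whole
  -- module.
  obtain ⟨ρ, hρ⟩ := LinearMap.exists_leftInverse_of_injective K'.subtype K'.ker_subtype
  let b := (Module.finBasisOfFinrankEq k K' hd).equivFun
  refine ⟨(b.toLinearMap ∘ₗ ρ).restrictScalars R, ?_⟩
  have : ∀ x : K, (((b.toLinearMap ∘ₗ ρ).restrictScalars R).domRestrict K) x = b x := fun x => by
    have := LinearMap.congr_fun hρ (x : K')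
    simpa using congrArg b this
  have h2 : ((((b.toLinearMap ∘ₗ ρ).restrictScalars R).domRestrict K) : K → Fin d → k) = b :=
    funext this
  rw [h2]
  exact b.bijective

variable {A : GrAlg R} {e : ℕ} {t : Fin e → A.X 1}

lemma IsFreeOn.length_zero (hA : IsFreeOn A t) : Module.length R (A.X 0) = 1 := by
  have hs : Function.Surjective (LinearMap.toSpanSingleton R (A.X 0) A.one) := fun a => by
    obtain ⟨r, rfl⟩ := hA.exists_smul_one a
    exact ⟨r, rfl⟩
  have hk : LinearMap.ker (LinearMap.toSpanSingleton R (A.X 0) A.one) =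
      IsLocalRing.maximalIdeal R := by
    ext r
    exact hA.smul_one r
  rw [← ((LinearMap.quotKerEquivOfSurjective _ hs)).length_eq, hk, Module.length_eq_one_iff,
    isSimpleModule_iff_isCoatom]
  exact Ideal.isMaximal_def.1 inferInstance

lemma IsFreeOn.length_eq (hA : IsFreeOn A t) (n : ℕ) : Module.length R (A.X n) = (e ^ n : ℕ) := by
  induction n with
  | zero => simpa using hA.length_zero
  | succ n ih =>
    have := (LinearEquiv.ofBijective _ (hA.bijective n (by positivity))).length_eq
    rw [Module.length_pi, ih] at this
    push_cast at this ⊢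
    rw [← this, pow_succ']
    simp

/-- An extension of graded `A`-modules `0 → A → S → C → 0` such that `x ↦ (t_i x)_i` is bijective
on `S` and `C` is locally nilpotent. -/
structure IsInvertingExtension {S C : GrMod A} (t : Fin e → A.X 1) (ι : GrHom A.self S)
    (ð : GrHom S C) : Prop where
  injective : ∀ n, Function.Injective (ι.app n)
  exact : ∀ n, Function.Exact (ι.app n) (ð.app n)
  surjective : ∀ n, Function.Surjective (ð.app n)
  bijective : ∀ n, Function.Bijective (S.leftMul t n)
  nilpotent : C.LocallyNilpotent

namespace IsInvertingExtension

variable {S C : GrMod A} {ι : GrHom A.self S} {ð : GrHom S C}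
  (h : IsInvertingExtension t ι ð)
include h

omit [IsLocalRing R] in
lemma leftMul_surjective (n : ℤ) : Function.Surjective (C.leftMul t n) := by
  intro y
  choose z hz using fun i => h.surjective (n + 1) (y i)
  obtain ⟨x, hx⟩ := (h.bijective n).2 z
  exact ⟨ð.app n x, funext fun i => by rw [← ð.app_leftMul, hx, hz]⟩

/-- Snake lemma: `leftMul` is injective on `A` and bijective on `S`, so its kernel on `C` is
isomorphic to its cokernel on `A`. -/
lemma length_ker (hA : IsFreeOn A t) (he : 0 < e) (n : ℤ) :
    Module.length R (Fin e → A.X (n + 1)) =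
      Module.length R (A.X n) + Module.length R (LinearMap.ker (C.leftMul t n)) := by
  let u := LinearEquiv.ofBijective _ (h.bijective n)
  have hu : ∀ y i, S.leftMul t n (u.symm y) i = y i := fun y i =>
    congrFun (u.apply_symm_apply y) i
  let f : (Fin e → A.X (n + 1)) →ₗ[R] (Fin e → S.X (n + 1)) :=
    LinearMap.pi fun i => ι.app (n + 1) ∘ₗ LinearMap.proj i
  have hf : ∀ a i, f a i = ι.app (n + 1) (a i) := fun _ _ => rfl
  -- The snake map: push a tuple into `S`, divide it by the `t_i`, and project to `C`.
  let g : (Fin e → A.X (n + 1)) →ₗ[R] LinearMap.ker (C.leftMul t n) :=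
    LinearMap.codRestrict _ (ð.app n ∘ₗ u.symm.toLinearMap ∘ₗ f) fun a => by
      refine funext fun i => ?_
      change C.leftMul t n (ð.app n (u.symm (f a))) i = 0
      rw [← ð.app_leftMul, hu, hf]
      exact (h.exact (n + 1) _).2 ⟨_, rfl⟩
  refine Module.length_eq_add_of_exact (A.self.leftMul t n) g (hA.leftMul_injective he n) ?_ ?_
  · rintro ⟨x, hx⟩
    obtain ⟨y, rfl⟩ := h.surjective n x
    have hy : ∀ i, ∃ a, ι.app (n + 1) a = S.leftMul t n y i := fun i => by
      refine (h.exact (n + 1) _).1 ?_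
      rw [ð.app_leftMul]
      exact congrFun hx i
    choose a ha using hy
    refine ⟨a, Subtype.ext ?_⟩
    change ð.app n (u.symm (f a)) = _
    rw [show f a = u y from funext ha, u.symm_apply_apply]
  · intro a
    constructor
    · intro ha
      have ha' : ð.app n (u.symm (f a)) = 0 := congrArg Subtype.val ha
      obtain ⟨b, hb⟩ := (h.exact n _).1 ha'
      refine ⟨b, funext fun i => h.injective (n + 1) ?_⟩
      change ι.app (n + 1) (A.self.leftMul t n b i) = _
      rw [ι.app_leftMul, hb, hu, hf]
    · rintro ⟨b, rfl⟩
      refine Subtype.ext ?_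
      change ð.app n (u.symm (f _)) = 0
      have : f (A.self.leftMul t n b) = u (ι.app n b) :=
        funext fun i => ι.app_leftMul n b i
      exact (congrArg (fun z => ð.app n (u.symm z)) this).trans
        ((congrArg (ð.app n) (u.symm_apply_apply _)).trans ((h.exact n _).2 ⟨_, rfl⟩))

lemma length_ker_neg_one (hA : IsFreeOn A t) (he : 0 < e) {n : ℤ} (hn : n = -1) :
    Module.length R (LinearMap.ker (C.leftMul t n)) = e := by
  have h1 := h.length_ker hA he n
  have := hA.neg n (by omega)
  have h0 : ∀ m : ℤ, m = 0 → Module.length R (A.X m) = 1 := by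
    rintro _ rfl
    exact hA.length_zero
  rw [Module.length_pi, h0 _ (by omega), Module.length_eq_zero (M := A.X n), zero_add] at h1
  rw [← h1]
  simp

/-- The count is `e · e^{i+1} - e^i`. -/
lemma length_ker_natCast (hA : IsFreeOn A t) (he : 0 < e) {n : ℤ} {i : ℕ} (hn : n = i) :
    Module.length R (LinearMap.ker (C.leftMul t n)) = (e ^ i * (e ^ 2 - 1) : ℕ) := by
  subst hn
  have h1 := h.length_ker hA he i
  have h2 := hA.length_eq (i + 1)
  push_cast at h2
  rw [Module.length_pi, h2, hA.length_eq i] at h1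
  have h3 : e * e ^ (i + 1) = e ^ i + e ^ i * (e ^ 2 - 1) := by
    have : 1 ≤ e ^ 2 := Nat.one_le_pow _ _ he
    zify [this]
    ring
  have h4 : ((e ^ i : ℕ) : ℕ∞) + (e ^ i * (e ^ 2 - 1) : ℕ) =
      (e ^ i : ℕ) + Module.length R (LinearMap.ker (C.leftMul t i)) := by
    rw [← h1, ← Nat.cast_add, ← h3]
    simp
  exact (ENat.add_right_injective_of_ne_top (ENat.natCast_ne_top _) h4).symm

/-- A lift `y` to `S` has all `t_i y` in the image of `A^{n+1} = 0`, and `leftMul` is injective on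
`S`. -/
lemma ker_subsingleton (hA : IsFreeOn A t) {n : ℤ} (hn : n < -1) {x : C.X n}
    (hx : C.leftMul t n x = 0) : x = 0 := by
  obtain ⟨y, rfl⟩ := h.surjective n x
  have hy : y = 0 := by
    refine (h.bijective n).1 (funext fun i => ?_)
    obtain ⟨a, ha⟩ := (h.exact (n + 1) (S.leftMul t n y i)).1 (by
      rw [ð.app_leftMul]
      exact congrFun hx i)
    have := hA.neg (n + 1) (by omega)
    have h0 : a = 0 := Subsingleton.elim (α := A.X (n + 1)) _ _
    rw [← ha, h0, map_zero, map_zero]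
    rfl
  rw [hy, map_zero]

/-- The functionals are the coordinates of maps restricting to isomorphisms from the socle to powers
of `k`. A socle element of degree `n` accounts for a summand shifted by `-n`, hence the shift 1 in
degree -1. -/
lemma nonempty_socleDual (hA : IsFreeOn A t) (he : 0 < e) :
    Nonempty (SocleDual C t (ι := Fin e ⊕ (Σ i : ℕ, Fin (e ^ i * (e ^ 2 - 1))))
      (Sum.elim (fun _ => 1) (fun p => -(p.1 : ℤ)))) := by
  choose L hL using fun (n : ℤ) (hn : n = -1) => exists_bijective_domRestrict
    (fun r hr (x : C.X n) => hA.smul_eq_zero C x hr) (LinearMap.ker (C.leftMul t n)) e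
    (h.length_ker_neg_one hA he hn)
  choose L' hL' using fun (i : ℕ) (n : ℤ) (hn : n = i) => exists_bijective_domRestrict
    (fun r hr (x : C.X n) => hA.smul_eq_zero C x hr) (LinearMap.ker (C.leftMul t n)) _
    (h.length_ker_natCast hA he hn)
  refine ⟨⟨fun c n hn => match c, hn with
    | Sum.inl j, hn => LinearMap.proj j ∘ₗ L n (by simp at hn; omega)
    | Sum.inr ⟨i, j⟩, hn => LinearMap.proj j ∘ₗ L' i n (by simp at hn; omega),
    fun n => ?_, fun n x hx hl => ?_, ?_⟩⟩
  · refine Set.Finite.subset (Set.Finite.union (Set.finite_range Sum.inl)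
      (Set.finite_range fun j : Fin (e ^ n.toNat * (e ^ 2 - 1)) => Sum.inr ⟨n.toNat, j⟩)) ?_
    rintro (j | ⟨i, j⟩) hc
    · exact Or.inl ⟨j, rfl⟩
    · simp only [Set.mem_ofPred_eq, Sum.elim_inr] at hc
      obtain rfl : i = n.toNat := by omega
      exact Or.inr ⟨j, rfl⟩
  · rcases lt_trichotomy n (-1) with hn | hn | hn
    · exact h.ker_subsingleton hA hn hx
    · have := (hL n hn).1 (a₁ := ⟨x, hx⟩) (a₂ := 0) (funext fun j => by
        rw [map_zero]
        exact hl (Sum.inl j) (by simp; omega))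
      exact congrArg Subtype.val this
    · have := (hL' n.toNat n (by omega)).1 (a₁ := ⟨x, hx⟩) (a₂ := 0) (funext fun j => by
        rw [map_zero]
        exact hl (Sum.inr ⟨n.toNat, j⟩) (by simp; omega))
      exact congrArg Subtype.val this
  · rintro (j | ⟨i, j⟩) n hn
    · have hn' : n = -1 := by simp at hn; omega
      obtain ⟨⟨x, hx⟩, hx'⟩ := (hL n hn').2 (Pi.single j 1)
      refine ⟨x, hx, (congrFun hx' j).trans (Pi.single_eq_same _ _), ?_⟩
      rintro (j' | ⟨i', j'⟩) hj hne
      · exact (congrFun hx' j').trans (Pi.single_eq_of_ne (fun h => hne (by rw [h])) _)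
      · simp at hj; omega
    · have hn' : n = i := by simp at hn; omega
      obtain ⟨⟨x, hx⟩, hx'⟩ := (hL' i n hn').2 (Pi.single j 1)
      refine ⟨x, hx, (congrFun hx' j).trans (Pi.single_eq_same _ _), ?_⟩
      rintro (j' | ⟨i', j'⟩) hj hne
      · simp at hj; omega
      · obtain rfl : i = i' := by simp at hj; omega
        exact (congrFun hx' j').trans (Pi.single_eq_of_ne (fun h => hne (by rw [h])) _)

/-- The cokernel of an inverting extension of a free algebra is cofree. -/
theorem exists_bijective_shiftSum (hA : IsFreeOn A t) (he : 0 < e) :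
    ∃ φ : GrHom C (shiftSum (A.dual k) e), ∀ n, Function.Bijective (φ.app n) := by
  obtain ⟨l⟩ := h.nonempty_socleDual hA he
  have hs : shiftSum (A.dual k) e = GrMod.coprod fun c => (A.dual k).shift
      (Sum.elim (fun _ : Fin e => 1)
        (fun p : (Σ i : ℕ, Fin (e ^ i * (e ^ 2 - 1))) => -(p.1 : ℤ)) c) := by
    refine congrArg GrMod.coprod (funext fun c => ?_)
    rcases c with _ | _ <;> rfl
  rw [hs]
  exact ⟨l.hom hA h.nilpotent, l.bijective_hom hA h.nilpotent h.leftMul_surjective⟩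

end IsInvertingExtension

end Extension

/-! ## Consequences for the total module -/

section Total

variable {R : Type u} [CommRing R] {A : GrAlg R} {e : ℕ} {t : Fin e → A.X 1}

lemma GrMod.of_smul_apply (M : GrMod A) {i n m : ℤ} (h : i + n = m) (a : A.X i) (x : M.Total) :
    (DirectSum.of A.X i a • x : M.Total) m = M.act h a (x n) := by
  subst h
  induction x using DirectSum.induction_on with
  | zero => simp
  | add x y hx hy => rw [smul_add, DirectSum.add_apply, hx, hy, DirectSum.add_apply, map_add]
  | of j x =>
    rw [DirectSum.Gmodule.of_smul_of]
    by_cases hj : j = n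
    · subst hj
      rw [DirectSum.of_eq_same]
      exact DirectSum.of_eq_same _ _
    · rw [DirectSum.of_eq_of_ne _ _ _ (Ne.symm hj), map_zero]
      exact DirectSum.of_eq_of_ne _ _ _ (by simpa using Ne.symm hj)

lemma GrMod.total_bijective {M : GrMod A} (h : ∀ n, Function.Bijective (M.leftMul t n)) :
    Function.Bijective fun (x : M.Total) i => DirectSum.of A.X 1 (t i) • x := by
  let f : M.Total →+ (Fin e → M.Total) :=
    { toFun := fun x i => DirectSum.of A.X 1 (t i) • x
      map_zero' := by ext; simp
      map_add' := fun x y => by ext; simp }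
  change Function.Bijective f
  constructor
  · rw [injective_iff_map_eq_zero]
    intro x hx
    refine DFinsupp.ext fun n => (h n).1 (funext fun i => ?_)
    have h1 := GrMod.of_smul_apply M (add_comm 1 n) (t i) x
    rw [show DirectSum.of A.X 1 (t i) • x = 0 from congrFun hx i] at h1
    exact h1.symm.trans (map_zero (M.act (add_comm 1 n) (t i))).symm
  -- The image is an additive subgroup, so tuples with a single nonzero homogeneous entry suffice.
  · rw [← AddMonoidHom.range_eq_top, eq_top_iff]
    intro y _
    rw [← Finset.univ_sum_single y]
    refine sum_mem fun i _ => ?_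
    induction y i using DirectSum.induction_on with
    | zero => simp
    | add x y hx hy => rw [Pi.single_add]; exact add_mem hx hy
    | of j x =>
      obtain ⟨n, rfl⟩ : ∃ n, j = n + 1 := ⟨j - 1, by omega⟩
      obtain ⟨z, hz⟩ := (h n).2 (Pi.single i x)
      refine ⟨DirectSum.of M.X n z, funext fun i' => ?_⟩
      change DirectSum.of A.X 1 (t i') • DirectSum.of M.X n z = _
      have key : ∀ m (hm : 1 + n = m), DirectSum.of M.X (1 + n) (M.act rfl (t i') z) =
          DirectSum.of M.X m (M.act hm (t i') z) := by rintro _ rfl; rfl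
      rw [DirectSum.Gmodule.of_smul_of]
      refine (key (n + 1) (add_comm 1 n)).trans ?_
      rw [← M.leftMul_apply, hz]
      by_cases hi : i' = i
      · subst hi; simp
      · simp [hi]

variable [IsLocalRing R]

lemma IsFreeOn.rightMul_total_injective (hA : IsFreeOn A t) :
    Function.Injective (Fintype.linearCombination A.Total
      fun i => DirectSum.of A.X 1 (t i)) := by
  rw [injective_iff_map_eq_zero]
  intro a ha
  have hcomp : ∀ (x : A.Total) (n : ℤ) (i : Fin e),
      (x * DirectSum.of A.X 1 (t i)) (n + 1) = A.mul rfl (x n) (t i) := by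
    intro x n i
    induction x using DirectSum.induction_on with
    | zero => simp
    | add x y hx hy =>
      rw [add_mul, DirectSum.add_apply, hx, hy, DirectSum.add_apply, LinearMap.map_add₂]
    | of j x =>
      rw [DirectSum.of_mul_of]
      by_cases hj : j = n
      · subst hj
        rw [DirectSum.of_eq_same, DirectSum.of_eq_same]
        rfl
      · rw [DirectSum.of_eq_of_ne _ _ _ (Ne.symm hj), LinearMap.map_zero₂]
        exact DirectSum.of_eq_of_ne _ _ _ (by simpa using Ne.symm hj)
  have h0 : ∀ n, (fun i => a i n) = 0 := by
    intro n
    rcases lt_or_ge n 0 with hn | hn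
    · have := hA.neg n hn
      exact Subsingleton.elim _ _
    refine (hA.bijective n hn).1 ?_
    rw [map_zero, GrAlg.rightMul_apply]
    have h1 := congrArg (fun x : A.Total => x (n + 1)) ha
    simp only [Fintype.linearCombination_apply, smul_eq_mul] at h1
    rw [DFinsupp.finsetSum_apply] at h1
    rw [← Finset.sum_congr rfl fun i _ => hcomp (a i) n i]
    exact h1
  exact funext fun i => DFinsupp.ext fun n => congrFun (h0 n) i

lemma IsFreeOn.range_rightMul_total (hA : IsFreeOn A t) :
    LinearMap.range (Fintype.linearCombination A.Total
      fun i => DirectSum.of A.X 1 (t i)) = A.posIdeal := by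
  rw [Fintype.range_linearCombination]
  refine le_antisymm (Submodule.span_le.2 ?_) (Submodule.span_le.2 ?_)
  · rintro _ ⟨i, rfl⟩
    exact Submodule.subset_span ⟨1, le_rfl, t i, rfl⟩
  · rintro _ ⟨n, hn, a, rfl⟩
    obtain ⟨m, rfl⟩ : ∃ m, n = m + 1 := ⟨n - 1, by omega⟩
    obtain ⟨b, rfl⟩ := hA.exists_rightMul (by omega) rfl a
    rw [map_sum]
    refine sum_mem fun i _ => ?_
    have : DirectSum.of A.X (m + 1) (A.mul rfl (b i) (t i)) =
        DirectSum.of A.X m (b i) • DirectSum.of A.X 1 (t i) :=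
      (DirectSum.of_mul_of _ _).symm
    rw [this]
    exact Submodule.smul_mem _ _ (Submodule.subset_span ⟨i, rfl⟩)

/-- If `x ↦ (t_i x)_i` is bijective on `M`, then `Ext(A / A^(≥ 1), M) = 0`. -/
theorem IsFreeOn.subsingleton_ext (hA : IsFreeOn A t) {M : GrMod A}
    (h : ∀ n, Function.Bijective (M.leftMul t n)) (n : ℕ) :
    Subsingleton (Abelian.Ext (ModuleCat.of A.Total A.Residue)
      (ModuleCat.of A.Total M.Total) n) := by
  have hM := GrMod.total_bijective h
  have hpos : ∀ i, DirectSum.of A.X 1 (t i) ∈ A.posIdeal := fun i =>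
    Submodule.subset_span ⟨1, le_rfl, t i, rfl⟩
  let f := Fintype.linearCombination A.Total fun i => DirectSum.of A.X 1 (t i)
  -- The free resolution 0 → A^e → A → A/A^{≥1} → 0 given by right multiplication by the `t_i`.
  let S : ShortComplex (ModuleCat.{u} A.Total) :=
    ShortComplex.mk (X₁ := ModuleCat.of A.Total (Fin e → A.Total))
      (X₂ := ModuleCat.of A.Total A.Total) (X₃ := ModuleCat.of A.Total A.Residue)
      (ModuleCat.ofHom f) (ModuleCat.ofHom A.posIdeal.mkQ) (by
        refine ModuleCat.hom_ext (LinearMap.ext fun a => ?_)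
        refine (Submodule.Quotient.mk_eq_zero _).2 ?_
        rw [← hA.range_rightMul_total]
        exact ⟨a, rfl⟩)
  have hS : S.ShortExact :=
    { exact := by
        rw [ShortComplex.moduleCat_exact_iff]
        intro x hx
        have hx' : x ∈ A.posIdeal := (Submodule.Quotient.mk_eq_zero _).1 hx
        rw [← hA.range_rightMul_total] at hx'
        exact hx'
      mono_f := (ModuleCat.mono_iff_injective _).2 hA.rightMul_total_injective
      epi_g := (ModuleCat.epi_iff_surjective _).2 (Submodule.mkQ_surjective _) }
  have : Projective S.X₁ := ModuleCat.projective_of_free (Pi.basisFun A.Total (Fin e))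
  have : Projective S.X₂ := ModuleCat.projective_of_free (Module.Basis.singleton Unit A.Total)
  refine subsingleton_of_forall_eq 0 fun x => ?_
  rcases n with _ | n
  · obtain ⟨φ, rfl⟩ := Abelian.Ext.addEquiv₀.symm.surjective x
    have : φ = 0 := by
      -- The image of the class of 1 is killed by all `t_i`, and `leftMul` is injective on `M`.
      have h1 : φ.hom (Submodule.Quotient.mk 1) = 0 := hM.1 (funext fun i => by
        have h2 : DirectSum.of A.X 1 (t i) • (Submodule.Quotient.mk 1 : A.Residue) = 0 := by
          rw [← Submodule.Quotient.mk_smul, Submodule.Quotient.mk_eq_zero, smul_eq_mul, mul_one]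
          exact hpos i
        change DirectSum.of A.X 1 (t i) • φ.hom _ = DirectSum.of A.X 1 (t i) • 0
        rw [← map_smul, h2, map_zero, smul_zero])
      refine ModuleCat.hom_ext (LinearMap.ext fun x => ?_)
      obtain ⟨a, rfl⟩ := Submodule.Quotient.mk_surjective _ x
      have h3 : (Submodule.Quotient.mk a : A.Residue) = a • Submodule.Quotient.mk 1 := by
        rw [← Submodule.Quotient.mk_smul, smul_eq_mul, mul_one]
      rw [h3, map_smul, h1, smul_zero]
      rfl
    rw [this, map_zero]
  -- Positive Ext of the projective middle term vanishes, so `x` is the image of some `y` under the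
  -- connecting map.
  · obtain ⟨y, rfl⟩ := Abelian.Ext.contravariant_sequence_exact₃ hS _ x
      (Abelian.Ext.eq_zero_of_projective _) (add_comm 1 n)
    rcases n with _ | n
    · obtain ⟨ψ, rfl⟩ := Abelian.Ext.addEquiv₀.symm.surjective y
      -- A homomorphism from A^e is a tuple in `M`. It has the form `(t_i z)_i` by surjectivity, so
      -- it extends to `A` and is killed by the connecting map.
      have : ∃ ψ', ψ = S.f ≫ ψ' := by
        obtain ⟨z, hz⟩ := hM.2 fun i => ψ.hom (Pi.single i 1)
        refine ⟨ModuleCat.ofHom (LinearMap.toSpanSingleton A.Total M.Total z),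
          ModuleCat.hom_ext ((Pi.basisFun A.Total (Fin e)).ext fun i => ?_)⟩
        rw [Pi.basisFun_apply, ← congrFun hz i]
        change _ = f (Pi.single i 1) • z
        rw [Fintype.linearCombination_apply_single, one_smul]
      obtain ⟨ψ', rfl⟩ := this
      have := hS.extClass_comp_assoc (Abelian.Ext.mk₀ ψ') (h := add_comm 1 0)
      rw [Abelian.Ext.mk₀_comp_mk₀] at this
      exact this
    · rw [Abelian.Ext.eq_zero_of_projective y, Abelian.Ext.comp_zero]

/-- An inverting extension of a free algebra does not split. -/
theorem IsInvertingExtension.not_exists_isCompl {S C : GrMod A} {ι : GrHom A.self S}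
    {ð : GrHom S C} (h : IsInvertingExtension t ι ð) (hA : IsFreeOn A t) (he : 0 < e) :
    ¬ ∃ T : Submodule A.Total S.Total, IsCompl (LinearMap.range ι.total) T := by
  rintro ⟨T, hT⟩
  have hS := GrMod.total_bijective h.bijective
  obtain ⟨a, ha⟩ : ∃ a : A.X (-1 + 1), a ≠ 0 := by
    have : ∀ n : ℤ, n = 0 → ∃ a : A.X n, a ≠ 0 := by
      rintro _ rfl
      exact ⟨_, hA.one_ne_zero⟩
    exact this _ (by omega)
  obtain ⟨x, hx⟩ := (h.bijective (-1)).2 (Pi.single ⟨0, he⟩ (ι.app _ a))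
  have hx0 : x ≠ 0 := by
    rintro rfl
    rw [map_zero] at hx
    have := congrFun hx ⟨0, he⟩
    rw [Pi.single_eq_same] at this
    exact ha (h.injective _ (this.symm.trans (map_zero _).symm))
  have hmem : ∀ i, DirectSum.of A.X 1 (t i) • DirectSum.of S.X (-1) x ∈
      LinearMap.range ι.total := by
    intro i
    have h1 : DirectSum.of A.X 1 (t i) • DirectSum.of S.X (-1) x =
        DirectSum.of S.X (-1 + 1) (S.leftMul t (-1) x i) := DirectSum.Gmodule.of_smul_of _ _ _ _
    rw [h1, hx]
    by_cases hi : i = ⟨0, he⟩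
    · subst hi
      exact ⟨DirectSum.of A.X _ a, by
        rw [Pi.single_eq_same]
        exact DirectSum.map_of _ _ _⟩
    · rw [Pi.single_eq_of_ne hi, map_zero]
      exact zero_mem _
  obtain ⟨y, hy, z, hz, hyz⟩ := Submodule.mem_sup.1
    (hT.sup_eq_top ▸ Submodule.mem_top : DirectSum.of S.X (-1) x ∈ LinearMap.range ι.total ⊔ T)
  -- Every `t_i z` lies in both the image of `ι` and `T`, so it vanishes.
  have hz0 : z = 0 := hS.1 (funext fun i => by
    have h1 : DirectSum.of A.X 1 (t i) • z ∈ LinearMap.range ι.total ⊓ T := by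
      refine ⟨?_, T.smul_mem _ hz⟩
      rw [← sub_eq_of_eq_add' hyz.symm, smul_sub]
      exact sub_mem (hmem i) (Submodule.smul_mem _ _ hy)
    rw [hT.inf_eq_bot, Submodule.mem_bot] at h1
    exact h1.trans (smul_zero _).symm)
  rw [hz0, add_zero] at hyz
  obtain ⟨b, rfl⟩ := hy
  refine hx0 ?_
  have h1 := congrArg (fun w : S.Total => w (-1)) hyz
  have := hA.neg (-1) (by norm_num)
  have h2 : ι.total b (-1) = ι.app (-1) (b (-1)) := DirectSum.map_apply _ _ _
  have h3 : b (-1) = 0 := Subsingleton.elim (α := A.X (-1)) _ _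
  rw [← DirectSum.of_eq_same (β := S.X) (-1) x]
  exact h1.symm.trans (h2.trans (by rw [h3, map_zero]))

end Total

/-! ## Lifting of cochains along quasi-isomorphisms -/

section Lifting

universe v w

variable {C : Type w} [Category.{v} C] [Abelian C] {K F L : CochainComplex C ℤ}

lemma acyclic_mappingCone (φ : F ⟶ L) [QuasiIso φ] : (mappingCone φ).Acyclic := by
  rw [← HomotopyCategory.quotient_obj_mem_subcategoryAcyclic_iff_acyclic]
  have h1 := (HomotopyCategory.subcategoryAcyclic C).trW_iff_of_distinguished _
    (HomotopyCategory.mappingCone_triangleh_distinguished φ)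
  refine h1.1 ?_
  rw [← HomotopyCategory.quasiIso_eq_trW_subcategoryAcyclic]
  exact (HomotopyCategory.quotient_map_mem_quasiIso_iff φ).2
    ((HomologicalComplex.mem_quasiIso_iff φ).2 inferInstance)

lemma acyclic_shift (hL : L.Acyclic) (n : ℤ) : (L⟦n⟧).Acyclic := by
  rw [← HomotopyCategory.quotient_obj_mem_subcategoryAcyclic_iff_acyclic] at hL ⊢
  exact ObjectProperty.prop_of_iso _
    (((HomotopyCategory.quotient C (.up ℤ)).commShiftIso n).symm.app L)
    ((HomotopyCategory.subcategoryAcyclic C).le_shift n _ hL)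

/-- Cocycles from a K-projective complex to an acyclic one are coboundaries. -/
lemma exists_δ_eq_of_acyclic [K.IsKProjective] (hL : L.Acyclic) {m n : ℤ} (h : m + 1 = n)
    (z : Cochain K L n) (hz : δ n (n + 1) z = 0) : ∃ y : Cochain K L m, δ m n y = z := by
  -- A cocycle of degree `n` is a morphism to the shifted complex, which is null-homotopic by
  -- K-projectivity.
  let z' : Cocycle K (L⟦n⟧) 0 :=
    (Cocycle.mk z (n + 1) rfl hz).rightShift n 0 (zero_add n)
  have H := IsKProjective.homotopyZero (Cocycle.homOf z') (acyclic_shift hL n)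
  obtain ⟨y, hy⟩ := Cochain.equivHomotopy _ _ H
  -- Undoing the shift by `n` multiplies the differential by `(-1)^n`.
  refine ⟨n.negOnePow • y.rightUnshift m (by omega), ?_⟩
  rw [Cochain.ofHom_zero, add_zero, Cocycle.cochain_ofHom_homOf_eq_coe] at hy
  have h1 := y.δ_rightUnshift m (by omega) n 0 (by omega)
  rw [← hy] at h1
  rw [δ_units_smul, h1, smul_smul, Int.units_mul_self, one_smul]
  exact Cochain.rightUnshift_rightShift _ _ _ _

/-- Lifting of cochains from a K-projective complex along a quasi-isomorphism, relative to a given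
coboundary. -/
lemma exists_lift [K.IsKProjective] (φ : F ⟶ L) [QuasiIso φ] {l m n : ℤ} (hlm : l + 1 = m)
    (hmn : m + 1 = n) (α : Cochain K F n) (hα : δ n (n + 1) α = 0) (β : Cochain K L m)
    (h : δ m n β = α.comp (Cochain.ofHom φ) (add_zero n)) :
    ∃ (γ : Cochain K F m) (η : Cochain K L l), δ m n γ = α ∧
      β = γ.comp (Cochain.ofHom φ) (add_zero m) + δ l m η := by
  -- The hypothesis on `β` says that `(-α, β)` is a cocycle with values in the cone of `φ`. The cone
  -- is acyclic, so it bounds some `(γ, η)`; the sign comes from the differential of the cone.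
  have h0 : δ m (m + 1) (mappingCone.liftCochain φ (-α) β hmn) = 0 := by
    obtain rfl := hmn
    rw [mappingCone.δ_liftCochain φ (-α) β rfl _ rfl, δ_neg, hα, neg_zero, Cochain.zero_comp,
      neg_zero, zero_add, h, Cochain.neg_comp, add_neg_cancel, Cochain.zero_comp]
  obtain ⟨y, hy⟩ := exists_δ_eq_of_acyclic (acyclic_mappingCone φ) hlm _ h0
  obtain ⟨γ, η, rfl⟩ : ∃ γ η, y = mappingCone.liftCochain φ γ η hlm :=
    ⟨y.comp (mappingCone.fst φ).1 hlm, y.comp (mappingCone.snd φ) (add_zero l), by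
      rw [mappingCone.ext_cochain_to_iff _ _ _ hlm]
      simp⟩
  rw [mappingCone.δ_liftCochain φ γ η hlm n hmn, mappingCone.ext_cochain_to_iff _ _ _ hmn] at hy
  refine ⟨γ, η, ?_, ?_⟩
  · simpa using hy.1
  · simpa [add_comm] using hy.2.symm

end Lifting

/-! ## The minimal resolution of the residue field when `𝔪² = 0` -/

/-- The words of length `-p` in `e` letters. -/
abbrev Word (e : ℕ) (p : ℤ) : Type := {w : List (Fin e) // (w.length : ℤ) = -p}

section Words

variable {R : Type u} [CommRing R] {e : ℕ}

instance (p : ℤ) : Finite (Word e p) :=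
  Finite.of_injective (β := List.Vector (Fin e) (-p).toNat)
    (fun w => ⟨w.1, by have := w.2; omega⟩)
    (fun _ _ h => Subtype.ext (congrArg (fun z : List.Vector (Fin e) _ => z.1) h))

lemma isEmpty_word {p : ℤ} (hp : 0 < p) : IsEmpty (Word e p) :=
  ⟨fun w => by have := w.2; omega⟩

/-- The linear map on functions of words which contracts the last letter with `x`. -/
def wordD (x : Fin e → R) (p q : ℤ) : (Word e p → R) →ₗ[R] (Word e q → R) :=
  if h : p + 1 = q then
    LinearMap.pi fun w => ∑ a, x a • LinearMap.proj ⟨w.1 ++ [a], by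
      rw [List.length_append, List.length_singleton, Nat.cast_add, w.2]
      push_cast
      omega⟩
  else 0

lemma wordD_apply (x : Fin e → R) {p q : ℤ} (h : p + 1 = q) (f : Word e p → R) (w : Word e q)
    (h' : ∀ a, ((w.1 ++ [a]).length : ℤ) = -p) :
    wordD x p q f w = ∑ a, x a * f ⟨w.1 ++ [a], h' a⟩ := by
  simp [wordD, h]

/-- The linear map on functions of words which fixes the first letter. -/
def wordTail (i : Fin e) (p q : ℤ) (h : p + 1 = q) : (Word e p → R) →ₗ[R] (Word e q → R) :=
  LinearMap.pi fun w => LinearMap.proj ⟨i :: w.1, by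
    rw [List.length_cons, Nat.cast_add, w.2]
    push_cast
    omega⟩

/-- The linear map on functions of words which prepends a letter. -/
def wordCons (i : Fin e) (p q : ℤ) (h : p + -1 = q) : (Word e p → R) →ₗ[R] (Word e q → R) :=
  LinearMap.pi fun w => match w with
    | ⟨[], _⟩ => 0
    | ⟨j :: w, hw⟩ => if j = i then LinearMap.proj ⟨w, by
        rw [List.length_cons] at hw; push_cast at hw; omega⟩ else 0

lemma wordTail_wordCons (i j : Fin e) (p q : ℤ) (h : p + -1 = q) (h' : q + 1 = p)
    (f : Word e p → R) :
    wordTail i q p h' (wordCons j p q h f) = if i = j then f else 0 := by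
  funext w
  simp only [wordTail, wordCons, LinearMap.pi_apply, LinearMap.proj_apply]
  split_ifs <;> simp

lemma sum_wordCons_wordTail {p q : ℤ} (h : p + 1 = q) (h' : q + -1 = p) (hp : p < 0)
    (f : Word e p → R) : ∑ i, wordCons i q p h' (wordTail i p q h f) = f := by
  funext ⟨w, hw⟩
  rw [Finset.sum_apply]
  match w, hw with
  | [], hw => simp at hw; omega
  | j :: w, hw =>
    rw [Finset.sum_eq_single j]
    · simp [wordTail, wordCons]
    · intro i _ hi
      simp [wordCons, hi.symm]
    · simp

/-- The two operations act at opposite ends of a word. This is what makes the tails cocycles. -/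
lemma wordTail_wordD (x : Fin e → R) (i : Fin e) {p q r : ℤ} (h : p + 1 = q) (h' : q + 1 = r)
    (f : Word e p → R) :
    wordTail i q r h' (wordD x p q f) = wordD x q r (wordTail i p q h f) := by
  funext w
  have := w.2
  rw [wordD_apply x h' _ _ (by simp; omega)]
  simp only [wordTail, LinearMap.pi_apply, LinearMap.proj_apply]
  rw [wordD_apply x h _ _ (by simp; omega)]
  rfl

lemma wordD_wordD (x : Fin e → R) (hx : ∀ a b, x a * x b = 0) (p q r : ℤ)
    (f : Word e p → R) : wordD x q r (wordD x p q f) = 0 := by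
  by_cases h : p + 1 = q
  · by_cases h' : q + 1 = r
    · funext w
      have := w.2
      rw [wordD_apply x h' _ _ (by simp; omega)]
      refine Finset.sum_eq_zero fun a _ => ?_
      rw [wordD_apply x h _ _ (by simp; omega), Finset.mul_sum]
      refine Finset.sum_eq_zero fun b _ => ?_
      rw [← mul_assoc, hx, zero_mul]
    · simp [wordD, h']
  · simp [wordD, h]

/-- With `mem_of_wordD_eq_zero` this gives exactness: cycles take values in the maximal ideal, and
all functions with such values are boundaries. -/
lemma exists_wordD_eq [IsLocalRing R] {x : Fin e → R}
    (hspan : ∀ y ∈ IsLocalRing.maximalIdeal R, ∃ r : Fin e → R, y = ∑ a, x a * r a)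
    {p q : ℤ} (h : p + 1 = q) (f : Word e q → R)
    (hf : ∀ w, f w ∈ IsLocalRing.maximalIdeal R) : ∃ g : Word e p → R, wordD x p q g = f := by
  choose r hr using fun w => hspan _ (hf w)
  -- The value at `w a` is the coefficient of `x a` in `f w`. The value 0 at the empty word is never
  -- used, since the differential evaluates only at words with a letter appended.
  refine ⟨fun w => if hw : w.1 ≠ [] then
    r ⟨w.1.dropLast, by
      have := w.2
      have := List.length_pos_iff.2 hw
      rw [List.length_dropLast]; omega⟩ (w.1.getLast hw) else 0, ?_⟩
  funext w
  have := w.2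
  rw [wordD_apply x h _ _ (by simp; omega), hr w]
  simp

lemma mem_of_wordD_eq_zero [IsLocalRing R] {x : Fin e → R}
    (hind : ∀ r : Fin e → R, ∑ a, x a * r a = 0 → ∀ a, r a ∈ IsLocalRing.maximalIdeal R)
    {p q : ℤ} (h : p + 1 = q) (hp : p < 0) (f : Word e p → R) (hf : wordD x p q f = 0)
    (w : Word e p) : f w ∈ IsLocalRing.maximalIdeal R := by
  obtain ⟨w, hw⟩ := w
  have hne : w ≠ [] := by
    rintro rfl
    simp at hw
    omega
  have hl : ∀ a, ((w.dropLast ++ [a]).length : ℤ) = -p := fun a => by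
    have := List.length_pos_iff.2 hne
    simp; omega
  have h1 := hind (fun a => f ⟨w.dropLast ++ [a], hl a⟩) (by
    rw [← wordD_apply x h f ⟨w.dropLast, by
      have := List.length_pos_iff.2 hne
      simp; omega⟩ hl, hf]
    rfl) (w.getLast hne)
  rwa [show (⟨w.dropLast ++ [w.getLast hne], hl _⟩ : Word e p) = ⟨w, hw⟩ from
    Subtype.ext (List.dropLast_append_getLast hne)] at h1

end Words

/-! ### The word complex, and its tail and cons cochains. -/

section WordComplex

variable {R : Type u} [CommRing R] {e : ℕ} (x : Fin e → R) (hx : ∀ a b, x a * x b = 0)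

/-- The complex of functions on words, with differential the contraction of the last letter. -/
noncomputable def wordComplex : CochainComplex (ModuleCat.{u} R) ℤ where
  X p := ModuleCat.of R (Word e p → R)
  d p q := ModuleCat.ofHom (wordD x p q)
  shape p q h := by
    have : ¬ p + 1 = q := h
    ext1
    simp [wordD, this]
  d_comp_d' p q r _ _ := by
    ext1
    exact LinearMap.ext fun f => wordD_wordD x hx p q r f

/-- The components of `tailCochain` up to sign. -/
noncomputable def tailHom (i : Fin e) (p q : ℤ) (h : p + 1 = q) :
    (wordComplex x hx).X p ⟶ (wordComplex x hx).X q := ModuleCat.ofHom (wordTail i p q h)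

/-- The components of `consCochain` up to sign. -/
noncomputable def consHom (i : Fin e) (p q : ℤ) (h : p + -1 = q) :
    (wordComplex x hx).X p ⟶ (wordComplex x hx).X q := ModuleCat.ofHom (wordCons i p q h)

lemma tailHom_comp_d (i : Fin e) (p q r : ℤ) (h : p + 1 = q) (h' : q + 1 = r) :
    tailHom x hx i p q h ≫ (wordComplex x hx).d q r =
      (wordComplex x hx).d p q ≫ tailHom x hx i q r h' :=
  ModuleCat.hom_ext (LinearMap.ext fun f => (wordTail_wordD x i h h' f).symm)

lemma consHom_comp_tailHom (i j : Fin e) (p q : ℤ) (h : p + -1 = q) (h' : q + 1 = p) :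
    consHom x hx j p q h ≫ tailHom x hx i q p h' = if i = j then 𝟙 _ else 0 := by
  refine ModuleCat.hom_ext (LinearMap.ext fun f =>
    (wordTail_wordCons i j p q h h' f).trans ?_)
  by_cases hij : i = j
  · rw [if_pos hij]
    exact if_pos hij
  · rw [if_neg hij]
    exact if_neg hij

lemma sum_tailHom_comp_consHom (p q : ℤ) (h : p + 1 = q) (h' : q + -1 = p) (hp : p < 0) :
    ∑ i, tailHom x hx i p q h ≫ consHom x hx i q p h' = 𝟙 _ := by
  refine ModuleCat.hom_ext (LinearMap.ext fun f => ?_)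
  rw [ModuleCat.hom_sum, LinearMap.sum_apply]
  exact sum_wordCons_wordTail h h' hp f

/-- The cochain of degree `1` which fixes the first letter. -/
noncomputable def tailCochain (i : Fin e) : Cochain (wordComplex x hx) (wordComplex x hx) 1 :=
  -- In degree 1 the differential is `∂β + β∂`, so a family commuting with `∂` needs alternating
  -- signs to be a cocycle.
  Cochain.mk fun p q h => p.negOnePow • tailHom x hx i p q h

/-- The cochain of degree `-1` which prepends a letter. -/
noncomputable def consCochain (i : Fin e) :
    Cochain (wordComplex x hx) (wordComplex x hx) (-1) :=
  -- The sign is that of `tailCochain` on the component starting in degree `q`, so both cancel in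
  -- compositions.
  Cochain.mk fun p q h => q.negOnePow • consHom x hx i p q h

lemma δ_tailCochain (i : Fin e) : δ 1 2 (tailCochain x hx i) = 0 := by
  refine Cochain.ext _ _ fun p q h => ?_
  rw [δ_v 1 2 rfl _ p q h (p + 1) (p + 1) (by omega) rfl]
  have h2 : (2 : ℤ).negOnePow = 1 := rfl
  simp only [tailCochain, Cochain.mk_v, h2, one_smul, Cochain.zero_v, Linear.units_smul_comp,
    Linear.comp_units_smul, Int.negOnePow_succ]
  rw [tailHom_comp_d x hx i p (p + 1) q rfl (by omega), Units.neg_smul, add_neg_cancel]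

lemma consCochain_comp_tailCochain (i j : Fin e) :
    (consCochain x hx j).comp (tailCochain x hx i) (neg_add_cancel 1) =
      if i = j then Cochain.ofHom (𝟙 _) else 0 := by
  refine Cochain.ext₀ _ _ fun p => ?_
  rw [Cochain.comp_v _ _ _ p (p + -1) p rfl (by omega)]
  simp only [consCochain, tailCochain, Cochain.mk_v, Linear.units_smul_comp,
    Linear.comp_units_smul, smul_smul, Int.units_mul_self, one_smul]
  rw [consHom_comp_tailHom]
  split_ifs
  · rw [Cochain.ofHom_v, HomologicalComplex.id_f]
  · rw [Cochain.zero_v]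

/-- The projection of the complex of functions on words to degree `0`, as a cochain. -/
noncomputable def emptyCochain : Cochain (wordComplex x hx) (wordComplex x hx) 0 :=
  Cochain.ofHom (𝟙 _) -
    ∑ i, (tailCochain x hx i).comp (consCochain x hx i) (add_neg_cancel 1)

lemma sum_v {F G : CochainComplex (ModuleCat.{u} R) ℤ} {n : ℤ} {ι : Type} (s : Finset ι)
    (z : ι → Cochain F G n) (p q : ℤ) (h : p + n = q) :
    (∑ i ∈ s, z i).v p q h = ∑ i ∈ s, (z i).v p q h :=
  map_sum (AddMonoidHom.mk' (fun z : Cochain F G n => z.v p q h)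
    fun _ _ => Cochain.add_v _ _ _ _ _) _ _

lemma wordComplex_isZero {p : ℤ} (hp : 0 < p) : Limits.IsZero ((wordComplex x hx).X p) := by
  have := isEmpty_word (e := e) hp
  exact ModuleCat.isZero_of_subsingleton (ModuleCat.of R (Word e p → R))

/-- A nonempty word is recovered from its first letter and its tail, so only the empty word
survives. -/
lemma emptyCochain_v {p : ℤ} (hp : p ≠ 0) (q : ℤ) (h : p + 0 = q) :
    (emptyCochain x hx).v p q h = 0 := by
  obtain rfl : p = q := by omega
  rcases lt_or_gt_of_ne hp with hp | hp
  · rw [emptyCochain, Cochain.sub_v, sum_v, sub_eq_zero, Cochain.ofHom_v,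
      HomologicalComplex.id_f, ← sum_tailHom_comp_consHom x hx p (p + 1) rfl (by omega) hp]
    refine Finset.sum_congr rfl fun i _ => ?_
    rw [Cochain.comp_v _ _ _ p (p + 1) p rfl (by omega)]
    simp only [consCochain, tailCochain, Cochain.mk_v, Linear.units_smul_comp,
      Linear.comp_units_smul, smul_smul, Int.units_mul_self, one_smul]
  · exact (wordComplex_isZero x hx hp).eq_of_src _ _

instance : (wordComplex x hx).IsKProjective := by
  have : (wordComplex x hx).IsStrictlyLE 0 :=
    (CochainComplex.isStrictlyLE_iff _ _).2 fun _ hi => wordComplex_isZero x hx hi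
  have : ∀ n, Projective ((wordComplex x hx).X n) := fun n =>
    ModuleCat.projective_of_free (M := ModuleCat.of R (Word e n → R)) (Pi.basisFun R (Word e n))
  exact isKProjective_of_projective _ 0

end WordComplex

/-! ### The word complex as a minimal resolution of the residue field. -/

section Augmentation

variable {R : Type u} [CommRing R] [IsLocalRing R] {e : ℕ} (x : Fin e → R)
  (hx : ∀ a b, x a * x b = 0) (hmem : ∀ a, x a ∈ IsLocalRing.maximalIdeal R)

local notation "k" => IsLocalRing.ResidueField R

variable (R) in
/-- The residue field as a complex. -/
noncomputable abbrev residueComplex : CochainComplex (ModuleCat.{u} R) ℤ :=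
  (CochainComplex.singleFunctor (ModuleCat.{u} R) 0).obj (ModuleCat.of R k)

variable (R) in
/-- The residue field is the component of degree `0` of the complex it defines. -/
noncomputable def residueIso : (residueComplex R).X 0 ≅ ModuleCat.of R k :=
  HomologicalComplex.singleObjXSelf (.up ℤ) 0 (ModuleCat.of R k)

lemma residueComplex_isZero {q : ℤ} (hq : q ≠ 0) : Limits.IsZero ((residueComplex R).X q) :=
  HomologicalComplex.isZero_single_obj_X (.up ℤ) 0 _ q hq

lemma residueComplex_d (p q : ℤ) : (residueComplex R).d p q = 0 :=
  HomologicalComplex.single_obj_d _ _ _ _ _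

/-- The augmentation of the complex of functions on words, in degree `0`. -/
noncomputable def wordAug₀ : (wordComplex x hx).X 0 ⟶ ModuleCat.of R k :=
  ModuleCat.ofHom ((Algebra.linearMap R k) ∘ₗ LinearMap.proj (⟨[], rfl⟩ : Word e 0))

lemma wordAug₀_apply (f : Word e 0 → R) : (wordAug₀ x hx).hom f =
    IsLocalRing.residue R (f ⟨[], rfl⟩) := rfl

include hmem in
lemma residue_smul_eq_zero (a : Fin e) (y : k) : x a • y = 0 := by
  rw [Algebra.smul_def]
  have : algebraMap R k (x a) = 0 := (IsLocalRing.residue_eq_zero_iff _).2 (hmem a)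
  rw [this, zero_mul]

include hmem in
-- Minimality: the entries of the differential lie in the maximal ideal, which kills `k`.
lemma wordComplex_d_comp_eq_zero (p q : ℤ) (f : (wordComplex x hx).X q ⟶ ModuleCat.of R k) :
    (wordComplex x hx).d p q ≫ f = 0 := by
  by_cases hpq : p + 1 = q
  · refine ModuleCat.hom_ext (LinearMap.ext fun (g : Word e p → R) => ?_)
    have h1 : wordD x p q g = ∑ a, x a • fun w : Word e q => g ⟨w.1 ++ [a], by
        have := w.2
        simp; omega⟩ := by
      funext w
      have := w.2
      rw [wordD_apply x hpq _ _ (by simp; omega), Finset.sum_apply]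
      rfl
    change f.hom (wordD x p q g) = 0
    rw [h1]
    refine (map_sum f.hom _ _).trans (Finset.sum_eq_zero fun a _ => ?_)
    exact (map_smul f.hom _ _).trans (residue_smul_eq_zero x hmem a _)
  · rw [(wordComplex x hx).shape p q hpq, Limits.zero_comp]

/-- The augmentation of the complex of functions on words. -/
noncomputable def wordAug : wordComplex x hx ⟶ residueComplex R :=
  HomologicalComplex.mkHomToSingle (c := .up ℤ) (j := 0) (wordAug₀ x hx)
    fun _ _ => wordComplex_d_comp_eq_zero x hx hmem _ _ _

lemma wordAug_f_zero :
    (wordAug x hx hmem).f 0 ≫ (residueIso R).hom = wordAug₀ x hx := by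
  have := HomologicalComplex.mkHomToSingle_f (c := .up ℤ) (j := 0) (wordAug₀ x hx)
    fun _ _ => wordComplex_d_comp_eq_zero x hx hmem _ _ _
  rw [← cancel_mono (residueIso R).inv, Category.assoc, Iso.hom_inv_id, Category.comp_id]
  exact this

/-- By minimality, cohomology classes with values in `k` are the cochains themselves, with no
quotient to take. -/
lemma δ_residue {n m : ℤ} (z : Cochain (wordComplex x hx) (residueComplex R) n)
    (hmem : ∀ a, x a ∈ IsLocalRing.maximalIdeal R) : δ n m z = 0 := by
  by_cases h : n + 1 = m
  · refine Cochain.ext _ _ fun p q hpq => ?_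
    rw [δ_v n m h z p q hpq (q - 1) (p + 1) rfl rfl, residueComplex_d, Limits.comp_zero, zero_add,
      Cochain.zero_v]
    by_cases hq : q = 0
    · subst hq
      rw [← cancel_mono (residueIso R).hom, Linear.units_smul_comp, Category.assoc,
        wordComplex_d_comp_eq_zero x hx hmem, smul_zero, Limits.zero_comp]
    · exact (residueComplex_isZero hq).eq_of_tgt _ _
  · exact δ_shape _ _ h _

include hmem in
lemma quasiIso_wordAug
    (hspan : ∀ y ∈ IsLocalRing.maximalIdeal R, ∃ r : Fin e → R, y = ∑ a, x a * r a)
    (hind : ∀ r : Fin e → R, ∑ a, x a * r a = 0 → ∀ a, r a ∈ IsLocalRing.maximalIdeal R) :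
    QuasiIso (wordAug x hx hmem) := by
  rw [quasiIso_iff]
  intro p
  rcases lt_trichotomy p 0 with hp | rfl | hp
  · rw [quasiIsoAt_iff_exactAt']
    · rw [HomologicalComplex.exactAt_iff' _ (p - 1) p (p + 1) (by simp) (by simp),
        ShortComplex.moduleCat_exact_iff]
      intro f hf
      exact exists_wordD_eq hspan (by omega) _ (mem_of_wordD_eq_zero hind rfl hp f hf)
    · exact HomologicalComplex.exactAt_single_obj _ _ _ _ hp.ne
  · rw [quasiIsoAt_iff' _ (-1) 0 1 (by simp) (by simp), ShortComplex.quasiIso_iff_of_zeros']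
    · constructor
      · rw [ShortComplex.moduleCat_exact_iff]
        intro f hf
        refine exists_wordD_eq hspan (by omega) _ fun w => ?_
        have h1 : (wordAug₀ x hx).hom f = 0 := by
          rw [← wordAug_f_zero x hx hmem]
          exact (congrArg (residueIso R).hom.hom hf).trans (map_zero _)
        obtain rfl : w = ⟨[], rfl⟩ := by
          obtain ⟨w, hw⟩ := w
          exact Subtype.ext (List.length_eq_zero_iff.1 (by simpa using hw))
        exact (IsLocalRing.residue_eq_zero_iff _).1 h1
      · change Epi ((wordAug x hx hmem).f 0)
        have : Epi (wordAug₀ x hx) := by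
          rw [ModuleCat.epi_iff_surjective]
          intro y
          obtain ⟨r, rfl⟩ := IsLocalRing.residue_surjective y
          exact ⟨fun _ => r, rfl⟩
        rw [← wordAug_f_zero x hx hmem] at this
        have h2 : (wordAug x hx hmem).f 0 =
          ((wordAug x hx hmem).f 0 ≫ (residueIso R).hom) ≫ (residueIso R).inv := by simp
        rw [h2]
        infer_instance
    · exact (wordComplex_isZero x hx one_pos).eq_of_tgt _ _
    · exact residueComplex_d _ _
    · exact residueComplex_d _ _
  · rw [quasiIsoAt_iff_exactAt']
    · rw [HomologicalComplex.exactAt_iff]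
      exact ShortComplex.exact_of_isZero_X₂ _ (wordComplex_isZero x hx hp)
    · exact HomologicalComplex.exactAt_single_obj _ _ _ _ hp.ne'

lemma residue_cochain_ext {n : ℤ} {z z' : Cochain (wordComplex x hx) (residueComplex R) n}
    (h : ∀ p (hp : p + n = 0), z.v p 0 hp = z'.v p 0 hp) : z = z' := by
  refine Cochain.ext _ _ fun p q hpq => ?_
  by_cases hq : q = 0
  · subst hq
    exact h p hpq
  · exact (residueComplex_isZero hq).eq_of_tgt _ _

lemma residue_cochain_eq_zero {n : ℤ} (hn : n < 0)
    (z : Cochain (wordComplex x hx) (residueComplex R) n) : z = 0 :=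
  residue_cochain_ext x hx fun p hp =>
    (wordComplex_isZero x hx (show 0 < p by omega)).eq_of_src _ _

/-- A cochain of degree `n` to `k` lives on the words of length `n` only. -/
lemma emptyCochain_comp {n : ℤ} (hn : 0 < n)
    (z : Cochain (wordComplex x hx) (residueComplex R) n) :
    (emptyCochain x hx).comp z (zero_add n) = 0 := by
  refine residue_cochain_ext x hx fun p hp => ?_
  rw [Cochain.comp_v _ _ _ p p 0 (add_zero p) hp, emptyCochain_v x hx (by omega),
    Limits.zero_comp, Cochain.zero_v]

omit [IsLocalRing R] in
lemma wordZero_eq (f : Word e 0 → R) : f = f ⟨[], rfl⟩ • fun _ => (1 : R) := by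
  funext ⟨w, hw⟩
  obtain rfl : w = [] := List.length_eq_zero_iff.1 (by simpa using hw)
  simp

lemma exists_smul_wordAug (z : Cochain (wordComplex x hx) (residueComplex R) 0) :
    ∃ r : R, z = r • Cochain.ofHom (wordAug x hx hmem) := by
  obtain ⟨r, hr⟩ := IsLocalRing.residue_surjective
    ((residueIso R).hom.hom ((z.v 0 0 rfl).hom (fun _ : Word e 0 => (1 : R))))
  refine ⟨r, residue_cochain_ext x hx fun p hp => ?_⟩
  obtain rfl : p = 0 := by omega
  rw [Cochain.smul_v, Cochain.ofHom_v, ← cancel_mono (residueIso R).hom, Linear.smul_comp,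
    wordAug_f_zero]
  refine ModuleCat.hom_ext (LinearMap.ext fun (f : Word e 0 → R) => ?_)
  change (z.v 0 0 rfl ≫ (residueIso R).hom).hom f = r • (wordAug₀ x hx).hom f
  rw [wordAug₀_apply]
  conv_lhs => rw [wordZero_eq f]
  refine (map_smul (z.v 0 0 rfl ≫ (residueIso R).hom).hom _ _).trans ?_
  change f ⟨[], rfl⟩ • ((residueIso R).hom.hom ((z.v 0 0 rfl).hom (fun _ : Word e 0 => (1 : R))))
    = _
  rw [← hr, Algebra.smul_def, Algebra.smul_def, mul_comm]
  rfl

lemma smul_wordAug_eq_zero_iff (r : R) :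
    r • Cochain.ofHom (wordAug x hx hmem) = 0 ↔ r ∈ IsLocalRing.maximalIdeal R := by
  have key : ∀ f : Word e 0 → R, r • (wordAug₀ x hx).hom f =
      IsLocalRing.residue R r * IsLocalRing.residue R (f ⟨[], rfl⟩) := fun f => by
    rw [wordAug₀_apply, Algebra.smul_def]
    rfl
  rw [← IsLocalRing.residue_eq_zero_iff]
  constructor
  · intro h
    have h1 := Cochain.congr_v h 0 0 rfl
    rw [Cochain.smul_v, Cochain.ofHom_v, Cochain.zero_v, ← cancel_mono (residueIso R).hom,
      Linear.smul_comp, wordAug_f_zero, Limits.zero_comp] at h1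
    have h2 := key fun _ => 1
    rw [map_one, mul_one] at h2
    rw [← h2]
    exact congrArg (fun g : (wordComplex x hx).X 0 ⟶ ModuleCat.of R k =>
      g.hom (fun _ : Word e 0 => (1 : R))) h1
  · intro h
    refine residue_cochain_ext x hx fun p hp => ?_
    obtain rfl : p = 0 := by omega
    rw [Cochain.smul_v, Cochain.ofHom_v, Cochain.zero_v, ← cancel_mono (residueIso R).hom,
      Linear.smul_comp, wordAug_f_zero, Limits.zero_comp]
    refine ModuleCat.hom_ext (LinearMap.ext fun (f : Word e 0 → R) => ?_)
    refine (key f).trans ?_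
    rw [h, zero_mul]
    rfl

end Augmentation

/-! ## The absolute cohomology algebra -/

section Comparison

variable {R : Type u} [CommRing R] [IsLocalRing R] {e : ℕ}

/-- A K-projective resolution `G` of the residue field complex with the structure of the complex of
functions on words in `e` letters: the cochains `tail i` remove a letter, and `cons i` adds it. -/
structure WordResolution (R : Type u) [CommRing R] [IsLocalRing R] (e : ℕ) where
  /-- the complex -/
  G : CochainComplex (ModuleCat.{u} R) ℤ
  isKProjective : G.IsKProjective
  /-- the augmentation -/
  aug : G ⟶ residueComplex R
  quasiIso : QuasiIso aug
  /-- removing a letter -/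
  tail : Fin e → Cochain G G 1
  /-- adding a letter -/
  cons : Fin e → Cochain G G (-1)
  δ_tail : ∀ i, δ 1 2 (tail i) = 0
  cons_tail : ∀ i j, (cons j).comp (tail i) (neg_add_cancel 1) =
    if i = j then Cochain.ofHom (𝟙 _) else 0
  /-- the projection to degree `0` -/
  empty : Cochain G G 0
  empty_add : empty + ∑ i, (tail i).comp (cons i) (add_neg_cancel 1) = Cochain.ofHom (𝟙 _)
  empty_v : ∀ p, p ≠ 0 → ∀ q h, empty.v p q h = 0
  δ_eq_zero : ∀ n m (z : Cochain G (residueComplex R) n), δ n m z = 0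
  eq_zero : ∀ n < 0, ∀ z : Cochain G (residueComplex R) n, z = 0
  empty_comp : ∀ n, 0 < n → ∀ z : Cochain G (residueComplex R) n,
    empty.comp z (zero_add n) = 0
  exists_smul_aug : ∀ z : Cochain G (residueComplex R) 0, ∃ r : R, z = r • Cochain.ofHom aug
  smul_aug_eq_zero_iff : ∀ r : R,
    r • Cochain.ofHom aug = 0 ↔ r ∈ IsLocalRing.maximalIdeal R

attribute [instance] WordResolution.isKProjective WordResolution.quasiIso

/-- The comparison of a K-projective resolution with a word resolution. -/
structure Comparison (W : WordResolution R e) (F : CochainComplex (ModuleCat.{u} R) ℤ)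
    (π : F ⟶ residueComplex R) where
  /-- the comparison map -/
  f : Cochain F W.G 0
  /-- the inverse comparison map -/
  g : Cochain W.G F 0
  δ_f : δ 0 1 f = 0
  δ_g : δ 0 1 g = 0
  g_π : g.comp (Cochain.ofHom π) (add_zero 0) = Cochain.ofHom W.aug
  /-- the homotopy on the given resolution -/
  hF : Cochain F F (-1)
  /-- the homotopy on the word resolution -/
  hG : Cochain W.G W.G (-1)
  f_g : f.comp g (add_zero 0) = Cochain.ofHom (𝟙 _) + δ (-1) 0 hF
  g_f : g.comp f (add_zero 0) = Cochain.ofHom (𝟙 _) + δ (-1) 0 hG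

/-- Any two K-projective resolutions of `k` are homotopy equivalent, which makes the result
independent of the chosen resolution. -/
lemma nonempty_comparison (W : WordResolution R e) (F : CochainComplex (ModuleCat.{u} R) ℤ)
    [F.IsKProjective] (π : F ⟶ residueComplex R) [QuasiIso π] : Nonempty (Comparison W F π) := by
  obtain ⟨f, η, hf, hfη⟩ := exists_lift W.aug (K := F) (show (-1 : ℤ) + 1 = 0 by rfl)
    (show (0 : ℤ) + 1 = 1 by rfl) 0 (δ_zero _ _) (Cochain.ofHom π)
    (by rw [δ_ofHom, Cochain.zero_comp])
  obtain ⟨g, η', hg, hgη⟩ := exists_lift π (K := W.G) (show (-1 : ℤ) + 1 = 0 by rfl)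
    (show (0 : ℤ) + 1 = 1 by rfl) 0 (δ_zero _ _) (Cochain.ofHom W.aug)
    (by rw [δ_ofHom, Cochain.zero_comp])
  -- By minimality the homotopy term vanishes, so `g` is strictly compatible with the augmentations.
  rw [W.δ_eq_zero, add_zero] at hgη
  have hfg : δ 0 1 (f.comp g (add_zero 0)) = 0 := by
    rw [δ_zero_cochain_comp _ _ 1 rfl, hf, hg]
    simp
  have hgf : δ 0 1 (g.comp f (add_zero 0)) = 0 := by
    rw [δ_zero_cochain_comp _ _ 1 rfl, hf, hg]
    simp
  -- The cocycle `f g - 1` becomes the coboundary of `-η` after composition with `π`, so it is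
  -- itself a coboundary.
  obtain ⟨hF, _, h1, -⟩ := exists_lift π (K := F) (show (-2 : ℤ) + 1 = -1 by rfl)
    (show (-1 : ℤ) + 1 = 0 by rfl) (f.comp g (add_zero 0) - Cochain.ofHom (𝟙 _))
    (by rw [zero_add, δ_sub, hfg, δ_ofHom, sub_zero]) (-η) (by
      rw [Cochain.sub_comp, Cochain.comp_assoc_of_first_is_zero_cochain, ← hgη, δ_neg]
      conv_rhs => rw [hfη]
      simp)
  obtain ⟨hG, _, h2, -⟩ := exists_lift W.aug (K := W.G) (show (-2 : ℤ) + 1 = -1 by rfl)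
    (show (-1 : ℤ) + 1 = 0 by rfl) (g.comp f (add_zero 0) - Cochain.ofHom (𝟙 _))
    (by rw [zero_add, δ_sub, hgf, δ_ofHom, sub_zero]) 0 (by
      have h3 : g.comp (δ (-1) 0 η) (add_zero 0) = 0 := by
        have h4 := δ_zero_cochain_comp g η 0 rfl
        rw [W.δ_eq_zero, hg, Cochain.zero_comp, smul_zero, add_zero] at h4
        exact h4.symm
      rw [δ_zero, Cochain.sub_comp, Cochain.comp_assoc_of_first_is_zero_cochain,
        eq_sub_of_add_eq hfη.symm, Cochain.comp_sub, h3, sub_zero, ← hgη, Cochain.id_comp,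
        sub_self])
  exact ⟨⟨f, g, hf, hg, hgη.symm, hF, hG, by rw [h1]; abel, by rw [h2]; abel⟩⟩

namespace Comparison

variable {W : WordResolution R e} {F : CochainComplex (ModuleCat.{u} R) ℤ}
  {π : F ⟶ residueComplex R} (c : Comparison W F π)

/-- The cochains of degree `1` which correspond to removing a letter. -/
def gen (i : Fin e) : Cochain F F 1 :=
  c.f.comp ((W.tail i).comp c.g (add_zero 1)) (zero_add 1)

lemma δ_tail_g (i : Fin e) : δ 1 2 ((W.tail i).comp c.g (add_zero 1)) = 0 := by
  rw [δ_comp_zero_cochain _ _ 2 rfl, c.δ_g, W.δ_tail, Cochain.comp_zero, Cochain.zero_comp,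
    add_zero]

lemma δ_gen (i : Fin e) : δ 1 2 (c.gen i) = 0 := by
  rw [gen, δ_zero_cochain_comp _ _ 2 rfl, c.δ_tail_g, c.δ_f, Cochain.comp_zero, Cochain.zero_comp,
    smul_zero, add_zero]

lemma δ_g_comp {n : ℤ} (m : ℤ) {K : CochainComplex (ModuleCat.{u} R) ℤ} (z : Cochain F K n) :
    δ n m (c.g.comp z (zero_add n)) = c.g.comp (δ n m z) (zero_add m) := by
  by_cases h : n + 1 = m
  · rw [δ_zero_cochain_comp _ _ _ h, c.δ_g, Cochain.zero_comp, smul_zero, add_zero]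
  · rw [δ_shape _ _ h, δ_shape _ _ h, Cochain.comp_zero]

lemma δ_f_comp {n : ℤ} (m : ℤ) {K : CochainComplex (ModuleCat.{u} R) ℤ} (z : Cochain W.G K n) :
    δ n m (c.f.comp z (zero_add n)) = c.f.comp (δ n m z) (zero_add m) := by
  by_cases h : n + 1 = m
  · rw [δ_zero_cochain_comp _ _ _ h, c.δ_f, Cochain.zero_comp, smul_zero, add_zero]
  · rw [δ_shape _ _ h, δ_shape _ _ h, Cochain.comp_zero]

/-- The values of the absolute cohomology classes on words, on the level of cochains. -/
noncomputable def symbol₀ (n : ℤ) : Cochain F F n →ₗ[R] Cochain W.G (residueComplex R) n where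
  toFun α := c.g.comp (α.comp (Cochain.ofHom π) (add_zero n)) (zero_add n)
  map_add' α β := by rw [Cochain.add_comp, Cochain.comp_add]
  map_smul' r α := by rw [Cochain.smul_comp, Cochain.comp_smul]; rfl

lemma symbol₀_apply (n : ℤ) (α : Cochain F F n) : c.symbol₀ n α =
    c.g.comp (α.comp (Cochain.ofHom π) (add_zero n)) (zero_add n) := rfl

lemma symbol₀_δ (m n : ℤ) (γ : Cochain F F m) : c.symbol₀ n (δ m n γ) = 0 := by
  rw [symbol₀_apply, ← δ_comp_ofHom, ← c.δ_g_comp, W.δ_eq_zero]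

/-- The values of the absolute cohomology classes on words. -/
noncomputable def symbol (n : ℤ) :
    (zeroIdeal F).cohomologyAlg.X n →ₗ[R] Cochain W.G (residueComplex R) n :=
  Submodule.liftQ _ ((c.symbol₀ n).domRestrict _) fun α hα => by
    obtain ⟨γ, hγ⟩ := DGIdeal.exists_δ_of_bdy hα
    have hγ' : δ (n - 1) n γ = α.1 := hγ
    change c.symbol₀ n α.1 = 0
    rw [← hγ', symbol₀_δ]

lemma symbol_mk (n : ℤ) (α : (zeroIdeal F).cyc n) :
    c.symbol n (Submodule.Quotient.mk α) = c.symbol₀ n α.1 := rfl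

omit [IsLocalRing R] in
/-- Precomposition with a coboundary of degree `0` of a cocycle with values in a complex. -/
lemma comp_eq_add_δ {K M : CochainComplex (ModuleCat.{u} R) ℤ} (z : Cochain K K 0)
    (h : Cochain K K (-1)) (hz : z = Cochain.ofHom (𝟙 _) + δ (-1) 0 h) {l n : ℤ} (hl : l + 1 = n)
    (w : Cochain K M n) (hw : δ n (n + 1) w = 0) :
    ∃ y : Cochain K M l, z.comp w (zero_add n) = w + δ l n y := by
  refine ⟨n.negOnePow • h.comp w (by omega), ?_⟩
  rw [δ_units_smul, δ_comp h w (show -1 + n = l by omega) 0 (n + 1) n hl rfl rfl, hw,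
    Cochain.comp_zero, zero_add, smul_smul, Int.units_mul_self, one_smul, hz, Cochain.add_comp,
    Cochain.id_comp]

/-- The symbol is induced by Hom(F, F) → Hom(F, k) → Hom(G, k). Both maps are quasi-isomorphisms,
and the last complex has zero differential. -/
lemma symbol_injective [F.IsKProjective] [QuasiIso π] (n : ℤ) :
    Function.Injective (c.symbol n) := by
  rw [injective_iff_map_eq_zero]
  intro a ha
  induction a using Submodule.Quotient.induction_on with
  | H a =>
    obtain ⟨α, hα⟩ := a
    have hα' : δ n (n + 1) α = 0 := DGIdeal.δ_eq_zero_of_cyc hα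
    have hw : δ n (n + 1) (α.comp (Cochain.ofHom π) (add_zero n)) = 0 := by
      rw [δ_comp_ofHom, hα', Cochain.zero_comp]
    obtain ⟨y, hy⟩ := comp_eq_add_δ _ c.hF c.f_g (show n - 1 + 1 = n by omega) _ hw
    rw [Cochain.comp_assoc_of_first_is_zero_cochain,
      show c.g.comp (α.comp (Cochain.ofHom π) (add_zero n)) (zero_add n) = 0 from ha,
      Cochain.comp_zero] at hy
    obtain ⟨γ, η, hγ, -⟩ := exists_lift π (K := F) (show n - 2 + 1 = n - 1 by omega)
      (show n - 1 + 1 = n by omega) α hα' (-y)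
      (by rw [δ_neg]; exact neg_eq_of_add_eq_zero_left hy.symm)
    refine (Submodule.Quotient.mk_eq_zero _).2 ?_
    change α ∈ (zeroIdeal F).bdy n
    rw [← hγ]
    exact (zeroIdeal F).δ_mem_bdy γ

lemma symbol_surjective [F.IsKProjective] [QuasiIso π] (n : ℤ) :
    Function.Surjective (c.symbol n) := by
  intro w
  obtain ⟨α, η, hα, hη⟩ := exists_lift π (K := F) (show n - 1 + 1 = n by omega)
    (rfl : n + 1 = n + 1) 0 (δ_zero _ _) (c.f.comp w (zero_add n))
    (by rw [c.δ_f_comp, W.δ_eq_zero, Cochain.comp_zero, Cochain.zero_comp])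
  refine ⟨Submodule.Quotient.mk ⟨α, ?_⟩, ?_⟩
  · rw [DGIdeal.mem_cyc, hα]
    exact zero_mem _
  · obtain ⟨y, hy⟩ := comp_eq_add_δ _ c.hG c.g_f (show n - 1 + 1 = n by omega) w
      (W.δ_eq_zero _ _ _)
    rw [W.δ_eq_zero, add_zero, Cochain.comp_assoc_of_first_is_zero_cochain, hη,
      Cochain.comp_add, ← c.δ_g_comp, W.δ_eq_zero, add_zero] at hy
    exact hy

/-- The generators of the absolute cohomology algebra. -/
def genClass (i : Fin e) : (zeroIdeal F).cohomologyAlg.X 1 :=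
  Submodule.Quotient.mk (p := ((zeroIdeal F).bdy 1).submoduleOf ((zeroIdeal F).cyc 1))
    ⟨c.gen i, by rw [DGIdeal.mem_cyc, show (1 : ℤ) + 1 = 2 by rfl, c.δ_gen]; exact zero_mem _⟩

/-- Right multiplication by a generator applies the tail first. The composite `g f` that appears is
homotopic to the identity, and the homotopy contributes a coboundary in Hom(G, k), which is zero. -/
lemma symbol_mul {n m : ℤ} (h : n + 1 = m) (a : (zeroIdeal F).cohomologyAlg.X n) (i : Fin e) :
    c.symbol m ((zeroIdeal F).cohomologyAlg.mul h a (c.genClass i)) =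
      (W.tail i).comp (c.symbol n a) (by omega) := by
  induction a using Submodule.Quotient.induction_on with
  | H a =>
    obtain ⟨α, hα⟩ := a
    change c.symbol₀ m ((c.gen i).comp α (by omega)) = _
    rw [symbol_mk, symbol₀_apply, symbol₀_apply, gen]
    have hα' : δ n (n + 1) α = 0 := DGIdeal.δ_eq_zero_of_cyc hα
    obtain ⟨y, hy⟩ := comp_eq_add_δ _ c.hG c.g_f (show m - 1 + 1 = m by omega)
      ((W.tail i).comp (c.g.comp (α.comp (Cochain.ofHom π) (add_zero n)) (zero_add n))
        (show 1 + n = m by omega)) (W.δ_eq_zero _ _ _)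
    rw [W.δ_eq_zero, add_zero] at hy
    rw [← hy]
    simp only [Cochain.comp_assoc_of_first_is_zero_cochain,
      Cochain.comp_assoc_of_second_is_zero_cochain, Cochain.comp_assoc_of_third_is_zero_cochain]

/-- The absolute cohomology algebra of the residue field is free. -/
theorem isFreeOn [F.IsKProjective] [QuasiIso π] :
    IsFreeOn (zeroIdeal F).cohomologyAlg c.genClass := by
  have hone : c.symbol 0 (zeroIdeal F).cohomologyAlg.one = Cochain.ofHom W.aug := by
    change c.symbol₀ 0 (Cochain.ofHom (𝟙 F)) = _
    rw [symbol₀_apply, Cochain.id_comp, c.g_π]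
  have hmul : ∀ n a, c.symbol (n + 1) ((zeroIdeal F).cohomologyAlg.rightMul c.genClass n a) =
      ∑ i, (W.tail i).comp (c.symbol n (a i)) (add_comm 1 n) := fun n a => by
    rw [GrAlg.rightMul_apply]
    refine (map_sum (c.symbol (n + 1)) _ _).trans (Finset.sum_congr rfl fun i _ => ?_)
    exact c.symbol_mul rfl (a i) i
  have hcomp : ∀ {n l m : ℤ} (h : n + l = m) (z : Cochain W.G W.G n)
      (w : Fin e → Cochain W.G (residueComplex R) l),
      z.comp (∑ i, w i) h = ∑ i, z.comp (w i) h := fun h z w =>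
    map_sum (AddMonoidHom.mk' (fun w => z.comp w h) fun _ _ => Cochain.comp_add _ _ _ _) _ _
  have hcomp' : ∀ {n l m : ℤ} (h : n + l = m) (z : Fin e → Cochain W.G W.G n)
      (w : Cochain W.G (residueComplex R) l),
      (∑ i, z i).comp w h = ∑ i, (z i).comp w h := fun h z w =>
    map_sum (AddMonoidHom.mk' (fun z => Cochain.comp z w h)
      fun _ _ => Cochain.add_comp _ _ _ _) _ _
  refine ⟨fun n hn => ⟨fun a b => c.symbol_injective n ?_⟩, fun a => ?_, fun r => ?_,
    fun n hn => ⟨?_, fun b => ?_⟩⟩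
  · rw [W.eq_zero n hn (c.symbol n a), W.eq_zero n hn (c.symbol n b)]
  · obtain ⟨r, hr⟩ := W.exists_smul_aug (c.symbol 0 a)
    refine ⟨r, c.symbol_injective 0 ?_⟩
    rw [hr, ← hone]
    exact (map_smul (c.symbol 0) _ _).symm
  · rw [← W.smul_aug_eq_zero_iff, ← hone, ← (c.symbol 0).map_smul]
    exact (map_eq_zero_iff _ (c.symbol_injective 0)).symm
  · rw [injective_iff_map_eq_zero]
    intro a ha
    have h1 := hmul n a
    rw [ha, map_zero] at h1
    funext j
    refine c.symbol_injective n ?_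
    -- Prepending the letter `j` before removing the letter `i` isolates the coefficient of the
    -- generator `j`.
    have h2 := congrArg (fun w => (W.cons j).comp w (show -1 + (n + 1) = n by omega)) h1
    simp only [hcomp, Cochain.comp_zero] at h2
    have h3 : ∀ i, (W.cons j).comp ((W.tail i).comp (c.symbol n (a i)) (add_comm 1 n))
        (show -1 + (n + 1) = n by omega) = if i = j then c.symbol n (a i) else 0 := fun i => by
      rw [← Cochain.comp_assoc _ _ _ (neg_add_cancel 1) (add_comm 1 n) (by omega), W.cons_tail]
      split_ifs
      · rw [Cochain.id_comp]
      · rw [Cochain.zero_comp]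
    simp only [h3, Finset.sum_ite_eq', Finset.mem_univ, if_true] at h2
    rw [← h2]
    exact (map_zero (c.symbol n)).symm
  · choose a ha using fun i => c.symbol_surjective n
      ((W.cons i).comp (c.symbol (n + 1) b) (show -1 + (n + 1) = n by omega))
    refine ⟨a, c.symbol_injective (n + 1) ?_⟩
    rw [hmul]
    simp only [ha]
    -- Precompose with the decomposition of the identity by first letters. The part at the empty
    -- word drops out because the degree is positive.
    have h1 := congrArg (fun z => Cochain.comp z (c.symbol (n + 1) b) (zero_add _)) W.empty_add
    simp only [Cochain.add_comp, W.empty_comp (n + 1) (by omega), zero_add, hcomp',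
      Cochain.id_comp] at h1
    refine Eq.trans (Finset.sum_congr rfl fun i _ => ?_) h1
    rw [Cochain.comp_assoc _ _ _ (add_neg_cancel 1) (show -1 + (n + 1) = n by omega) (by omega)]

end Comparison

end Comparison

/-! ## Bounded cochains and the stable cohomology algebra -/

section Bounded

variable {R : Type u} [CommRing R] {K F M : CochainComplex (ModuleCat.{u} R) ℤ}

/-- A cochain is bounded if it vanishes on the components of large lower degree. -/
def IsBounded {n : ℤ} (z : Cochain K F n) : Prop :=
  ∃ N : ℤ, ∀ (i q : ℤ) (h : -i + n = q), N ≤ i → z.v (-i) q h = 0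

lemma isBounded_zero {n : ℤ} : IsBounded (0 : Cochain K F n) := ⟨0, fun _ _ _ _ => rfl⟩

lemma IsBounded.add {n : ℤ} {z w : Cochain K F n} (hz : IsBounded z) (hw : IsBounded w) :
    IsBounded (z + w) := by
  obtain ⟨N, hN⟩ := hz
  obtain ⟨N', hN'⟩ := hw
  refine ⟨max N N', fun i q h hi => ?_⟩
  rw [Cochain.add_v, hN i q h (le_trans (le_max_left _ _) hi),
    hN' i q h (le_trans (le_max_right _ _) hi), add_zero]

lemma IsBounded.neg {n : ℤ} {z : Cochain K F n} (hz : IsBounded z) : IsBounded (-z) := by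
  obtain ⟨N, hN⟩ := hz
  exact ⟨N, fun i q h hi => by rw [Cochain.neg_v, hN i q h hi, neg_zero]⟩

lemma IsBounded.units_smul {n : ℤ} {z : Cochain K F n} (hz : IsBounded z) (s : ℤˣ) :
    IsBounded (s • z) := by
  obtain ⟨N, hN⟩ := hz
  exact ⟨N, fun i q h hi => by rw [Cochain.units_smul_v, hN i q h hi, smul_zero]⟩

lemma IsBounded.sum {n : ℤ} {ι : Type} (s : Finset ι) {z : ι → Cochain K F n}
    (hz : ∀ i, IsBounded (z i)) : IsBounded (∑ i ∈ s, z i) :=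
  Finset.sum_induction _ _ (fun _ _ => IsBounded.add) isBounded_zero fun i _ => hz i

lemma IsBounded.comp {n m l : ℤ} {z : Cochain K F n} (hz : IsBounded z) (w : Cochain F M m)
    (h : n + m = l) : IsBounded (z.comp w h) := by
  obtain ⟨N, hN⟩ := hz
  refine ⟨N, fun p q hp hi => ?_⟩
  rw [Cochain.comp_v z w h (-p) (-p + n) q rfl (by omega), hN p _ rfl hi, Limits.zero_comp]

lemma IsBounded.comp_left {n m l : ℤ} {z : Cochain F M n} (hz : IsBounded z)
    (w : Cochain K F m) (h : m + n = l) : IsBounded (w.comp z h) := by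
  obtain ⟨N, hN⟩ := hz
  refine ⟨N + m, fun p q hp hi => ?_⟩
  rw [Cochain.comp_v w z h (-p) (-(p - m)) q (by omega) (by omega),
    hN (p - m) q (by omega) (by omega), Limits.comp_zero]

/-- A cochain is stably null if it is the sum of a coboundary and a bounded cochain. -/
def IsStablyNull {n : ℤ} (z : Cochain K F n) : Prop :=
  ∃ (γ : Cochain K F (n - 1)) (b : Cochain K F n), IsBounded b ∧ δ (n - 1) n γ + b = z

lemma isStablyNull_δ {m n : ℤ} (h : m + 1 = n) (γ : Cochain K F m) :
    IsStablyNull (δ m n γ) := by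
  obtain rfl : m = n - 1 := by omega
  exact ⟨γ, 0, isBounded_zero, add_zero _⟩

lemma IsBounded.isStablyNull {n : ℤ} {z : Cochain K F n} (hz : IsBounded z) :
    IsStablyNull z := ⟨0, z, hz, by rw [δ_zero, zero_add]⟩

lemma IsStablyNull.add {n : ℤ} {z w : Cochain K F n} (hz : IsStablyNull z)
    (hw : IsStablyNull w) : IsStablyNull (z + w) := by
  obtain ⟨γ, b, hb, rfl⟩ := hz
  obtain ⟨γ', b', hb', rfl⟩ := hw
  exact ⟨γ + γ', b + b', hb.add hb', by rw [δ_add]; abel⟩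

lemma IsStablyNull.neg {n : ℤ} {z : Cochain K F n} (hz : IsStablyNull z) :
    IsStablyNull (-z) := by
  obtain ⟨γ, b, hb, rfl⟩ := hz
  exact ⟨-γ, -b, hb.neg, by rw [δ_neg]; abel⟩

lemma IsStablyNull.sub {n : ℤ} {z w : Cochain K F n} (hz : IsStablyNull z)
    (hw : IsStablyNull w) : IsStablyNull (z - w) := by
  rw [sub_eq_add_neg]
  exact hz.add hw.neg

/-- The composition of a stable cocycle with a coboundary is stably null. -/
lemma isStablyNull_comp_δ {n m m' l : ℤ} (z : Cochain K F n)
    (hz : IsBounded (δ n (n + 1) z)) (w : Cochain F M m) (hm : m + 1 = m') (h : n + m' = l) :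
    IsStablyNull (z.comp (δ m m' w) h) := by
  have key := δ_comp z w (show n + m = l - 1 by omega) (n + 1) m' l (by omega) rfl hm
  rw [eq_sub_of_add_eq key.symm]
  exact (isStablyNull_δ (by omega) _).sub ((hz.comp w _).units_smul _).isStablyNull

/-- The composition of a stably null cochain with a cocycle is stably null. -/
lemma IsStablyNull.comp {n m l : ℤ} {z : Cochain K F n} (hz : IsStablyNull z)
    (w : Cochain F M m) (hw : δ m (m + 1) w = 0) (h : n + m = l) :
    IsStablyNull (z.comp w h) := by
  obtain ⟨γ, b, hb, rfl⟩ := hz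
  rw [Cochain.add_comp]
  refine IsStablyNull.add ?_ (hb.comp w h).isStablyNull
  have key := δ_comp γ w (show n - 1 + m = l - 1 by omega) n (m + 1) l (by omega) (by omega) rfl
  rw [hw, Cochain.comp_zero, zero_add] at key
  have : (δ (n - 1) n γ).comp w h = m.negOnePow • δ (l - 1) l (γ.comp w (by omega)) := by
    rw [key, smul_smul, Int.units_mul_self, one_smul]
  rw [this, ← δ_units_smul]
  exact isStablyNull_δ (by omega) _

/-- The composition of a stable cocycle with a cochain homotopic to the identity. -/
lemma isStablyNull_comp_sub {n : ℤ} (z : Cochain K F n) (hz : IsBounded (δ n (n + 1) z))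
    (w : Cochain F F 0) (h : Cochain F F (-1)) (hw : w = Cochain.ofHom (𝟙 _) + δ (-1) 0 h) :
    IsStablyNull (z.comp w (add_zero n) - z) := by
  rw [hw, Cochain.comp_add, Cochain.comp_id, add_sub_cancel_left]
  exact isStablyNull_comp_δ z hz h rfl _

end Bounded

/-! ### Division by the generators in stable cohomology. -/

section Stable

variable {R : Type u} [CommRing R] [IsLocalRing R] {e : ℕ} {W : WordResolution R e}

lemma WordResolution.isBounded_empty (W : WordResolution R e) : IsBounded W.empty :=
  ⟨1, fun i q h hi => W.empty_v (-i) (by omega) q h⟩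

/-- The tails determine `z` except for its component in degree 0 of `W.G`, which is bounded because
the degree of `z` is fixed. -/
lemma WordResolution.isBounded_of_tail {K : CochainComplex (ModuleCat.{u} R) ℤ} {n m : ℤ}
    (h : n + 1 = m) (z : Cochain K W.G n) (hz : ∀ i, IsBounded (z.comp (W.tail i) h)) :
    IsBounded z := by
  have hcomp : z.comp (∑ i, (W.tail i).comp (W.cons i) (add_neg_cancel 1)) (add_zero n) =
      ∑ i, z.comp ((W.tail i).comp (W.cons i) (add_neg_cancel 1)) (add_zero n) :=
    map_sum (AddMonoidHom.mk' (fun w => z.comp w (add_zero n))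
      fun _ _ => Cochain.comp_add _ _ _ _) _ _
  rw [← Cochain.comp_id z, ← W.empty_add, Cochain.comp_add, hcomp]
  refine (W.isBounded_empty.comp_left _ _).add (IsBounded.sum _ fun i => ?_)
  rw [← Cochain.comp_assoc _ _ _ h (add_neg_cancel 1) (by omega)]
  exact (hz i).comp _ _

lemma WordResolution.exists_comp_tail {K : CochainComplex (ModuleCat.{u} R) ℤ} {n m : ℤ}
    (h : n + 1 = m) (y : Fin e → Cochain K W.G m) :
    ∃ z : Cochain K W.G n, ∀ i, z.comp (W.tail i) h = y i := by
  refine ⟨∑ j, (y j).comp (W.cons j) (by omega), fun i => ?_⟩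
  have hcomp : (∑ j, (y j).comp (W.cons j) (show m + -1 = n by omega)).comp (W.tail i) h =
      ∑ j, ((y j).comp (W.cons j) (show m + -1 = n by omega)).comp (W.tail i) h :=
    map_sum (AddMonoidHom.mk' (fun w => Cochain.comp w (W.tail i) h)
      fun _ _ => Cochain.add_comp _ _ _ _) _ _
  rw [hcomp, Finset.sum_eq_single i]
  · rw [Cochain.comp_assoc _ _ _ _ (neg_add_cancel 1) (by omega), W.cons_tail, if_pos rfl,
      Cochain.comp_id]
  · intro j _ hj
    rw [Cochain.comp_assoc _ _ _ _ (neg_add_cancel 1) (by omega), W.cons_tail, if_neg hj.symm,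
      Cochain.comp_zero]
  · simp

lemma WordResolution.δ_comp_tail {K : CochainComplex (ModuleCat.{u} R) ℤ} {n m : ℤ}
    (h : n + 1 = m) (z : Cochain K W.G n) (i : Fin e) :
    (δ n m z).comp (W.tail i) rfl = -δ m (m + 1) (z.comp (W.tail i) h) := by
  rw [δ_comp z (W.tail i) h m 2 (m + 1) rfl h rfl, W.δ_tail, Cochain.comp_zero, zero_add,
    Int.negOnePow_one, Units.neg_smul, one_smul, neg_neg]

namespace Comparison

variable {F : CochainComplex (ModuleCat.{u} R) ℤ} {π : F ⟶ residueComplex R}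
  (c : Comparison W F π)

/-- Injectivity of `leftMul` on stable cohomology. Transported to the word resolution, the null data
for the separate letters are assembled into one cochain. -/
lemma isStablyNull_of_comp_gen {n : ℤ} (β : Cochain F F n) (hβ : IsBounded (δ n (n + 1) β))
    (h : ∀ i, IsStablyNull (β.comp (c.gen i) rfl)) : IsStablyNull β := by
  have h1 : ∀ i, IsStablyNull
      ((β.comp c.f (add_zero n)).comp (W.tail i) (rfl : n + 1 = n + 1)) := by
    intro i
    have h2 : IsBounded (δ (n + 1) (n + 1 + 1)
        ((β.comp c.f (add_zero n)).comp (W.tail i) (rfl : n + 1 = n + 1))) := by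
      rw [← neg_neg (δ _ _ _), ← W.δ_comp_tail rfl, δ_comp_zero_cochain _ _ _ rfl, c.δ_f,
        Cochain.comp_zero, zero_add]
      exact ((hβ.comp _ _).comp _ _).neg
    have h3 := ((h i).comp c.f c.δ_f (add_zero _)).sub
      (isStablyNull_comp_sub _ h2 _ c.hG c.g_f)
    have h4 : (β.comp (c.gen i) (rfl : n + 1 = n + 1)).comp c.f (add_zero _) =
        ((β.comp c.f (add_zero n)).comp (W.tail i) (rfl : n + 1 = n + 1)).comp
          (c.g.comp c.f (add_zero 0)) (add_zero _) := by
      simp only [gen, Cochain.comp_assoc_of_first_is_zero_cochain,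
        Cochain.comp_assoc_of_second_is_zero_cochain,
        Cochain.comp_assoc_of_third_is_zero_cochain]
    rw [h4, sub_sub_cancel] at h3
    exact h3
  choose γ b hb hγ using h1
  -- Since tails have odd degree, `δ` anticommutes with composition by them. So adding `δ ξ` cancels
  -- each `δ (γ i)` and leaves the bounded `b i`.
  obtain ⟨ξ, hξ⟩ := W.exists_comp_tail (show n - 1 + 1 = n + 1 - 1 by omega) γ
  have h2 : IsBounded (β.comp c.f (add_zero n) + δ (n - 1) n ξ) := by
    refine W.isBounded_of_tail rfl _ fun i => ?_
    have h5 := δ_comp ξ (W.tail i) (show n - 1 + 1 = n + 1 - 1 by omega) n 2 (n + 1) (by omega)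
      (by omega) rfl
    rw [W.δ_tail, Cochain.comp_zero, zero_add, Int.negOnePow_one, Units.neg_smul, one_smul,
      hξ i] at h5
    rw [Cochain.add_comp, ← hγ i, h5, neg_add_cancel_comm]
    exact hb i
  have h3 : IsStablyNull (β.comp c.f (add_zero n)) := by
    have := h2.isStablyNull.sub (isStablyNull_δ (show n - 1 + 1 = n by omega) ξ)
    rwa [add_sub_cancel_right] at this
  have h4 := (h3.comp c.g c.δ_g (add_zero n)).sub
    (isStablyNull_comp_sub β hβ _ c.hF c.f_g)
  rw [Cochain.comp_assoc_of_second_is_zero_cochain, sub_sub_cancel] at h4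
  exact h4

/-- Surjectivity of `leftMul` on stable cohomology. Prefixing letters glues the `β i` into one
cochain `ξ`; it is a stable cocycle because the tails of `δ ξ` are bounded. -/
lemma exists_comp_gen {n : ℤ} (β : Fin e → Cochain F F (n + 1))
    (hβ : ∀ i, IsBounded (δ (n + 1) (n + 1 + 1) (β i))) :
    ∃ α : Cochain F F n, IsBounded (δ n (n + 1) α) ∧
      ∀ i, IsStablyNull (α.comp (c.gen i) rfl - β i) := by
  obtain ⟨ξ, hξ⟩ := W.exists_comp_tail (rfl : n + 1 = n + 1)
    fun i => (β i).comp c.f (add_zero (n + 1))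
  have h1 : IsBounded (δ n (n + 1) ξ) := by
    refine W.isBounded_of_tail rfl _ fun i => ?_
    rw [W.δ_comp_tail rfl, hξ, δ_comp_zero_cochain _ _ _ rfl, c.δ_f, Cochain.comp_zero, zero_add]
    exact ((hβ i).comp _ _).neg
  refine ⟨ξ.comp c.g (add_zero n), ?_, fun i => ?_⟩
  · rw [δ_comp_zero_cochain _ _ _ rfl, c.δ_g, Cochain.comp_zero, zero_add]
    exact h1.comp _ _
  · have h2 := (isStablyNull_comp_sub ξ h1 _ c.hG c.g_f).comp
      ((W.tail i).comp c.g (add_zero 1)) (c.δ_tail_g i) (rfl : n + 1 = n + 1)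
    rw [Cochain.sub_comp] at h2
    have h3 : ξ.comp ((W.tail i).comp c.g (add_zero 1)) (rfl : n + 1 = n + 1) =
        (β i).comp (c.f.comp c.g (add_zero 0)) (add_zero _) := by
      rw [← Cochain.comp_assoc_of_third_is_zero_cochain, hξ,
        Cochain.comp_assoc_of_second_is_zero_cochain]
    have h4 : (ξ.comp (c.g.comp c.f (add_zero 0)) (add_zero n)).comp
        ((W.tail i).comp c.g (add_zero 1)) (rfl : n + 1 = n + 1) =
        (ξ.comp c.g (add_zero n)).comp (c.gen i) rfl := by
      simp only [gen, Cochain.comp_assoc_of_first_is_zero_cochain,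
        Cochain.comp_assoc_of_second_is_zero_cochain]
    rw [h3, h4] at h2
    have h5 := h2.add (isStablyNull_comp_sub (β i) (hβ i) _ c.hF c.f_g)
    rwa [sub_add_sub_cancel] at h5

end Comparison

end Stable

/-! ## The stable cohomology of the residue field -/

section Extension

variable {R : Type u} [CommRing R]

/-- The composition of a bounded homomorphism with a homomorphism of large degree vanishes. -/
lemma IsBounded.exists_comp_eq_zero {F : CochainComplex (ModuleCat.{u} R) ℤ}
    (hF : ∀ p, 0 < p → Limits.IsZero (F.X p)) {m : ℤ} {z : Cochain F F m} (hz : IsBounded z) :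
    ∃ K : ℕ, ∀ (i l : ℤ) (h : m + i = l), (K : ℤ) ≤ i → ∀ α : Cochain F F i, z.comp α h = 0 := by
  obtain ⟨N, hN⟩ := hz
  -- From homological degree at least `N`, `z` is zero. From below `N`, the composite of degree `m +
  -- i ≥ N` lands in positive cohomological degree, where `F` vanishes.
  refine ⟨(N - m).toNat, fun i l h hi α => Cochain.ext _ _ fun p q hpq => ?_⟩
  obtain ⟨p, rfl⟩ : ∃ p', p = -p' := ⟨-p, (neg_neg p).symm⟩
  rcases le_or_gt N p with hp | hp
  · rw [Cochain.comp_v z α h (-p) (-p + m) q rfl (by omega), hN p _ rfl hp, Limits.zero_comp,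
      Cochain.zero_v]
  · exact (hF q (by omega)).eq_of_tgt _ _

lemma mk_submoduleOf_eq_zero {M : Type u} [AddCommGroup M] [Module R M] {p q : Submodule R M}
    {x : M} (hx : x ∈ q) :
    (Submodule.Quotient.mk ⟨x, hx⟩ : q ⧸ p.submoduleOf q) = 0 ↔ x ∈ p :=
  Submodule.Quotient.mk_eq_zero _

lemma exists_δ_of_subBdy {F : CochainComplex (ModuleCat.{u} R) ℤ} {B : DGIdeal F} {n m : ℤ}
    (h : n + 1 = m) {β : Cochain F F m} (hβ : β ∈ B.subBdy m) : ∃ γ ∈ B.I n, δ n m γ = β := by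
  obtain rfl : n = m - 1 := by omega
  exact hβ

lemma exists_δ_of_bdy_zeroIdeal {F : CochainComplex (ModuleCat.{u} R) ℤ} {n m : ℤ}
    (h : n + 1 = m) {β : Cochain F F m} (hβ : β ∈ (zeroIdeal F).bdy m) :
    ∃ γ : Cochain F F n, δ n m γ = β := by
  obtain rfl : n = m - 1 := by omega
  exact DGIdeal.exists_δ_of_bdy hβ

variable [IsLocalRing R] {e : ℕ}

/-- This forces bounded cocycles to be trivial in absolute cohomology. If `x` is killed in degrees
at least `N + 1`, then each `t_j x` is killed in degrees at least `N`. -/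
lemma IsFreeOn.eq_zero_of_mul_eq_zero {A : GrAlg R} {t : Fin e → A.X 1} (hA : IsFreeOn A t)
    (he : 0 < e) (N : ℕ) : ∀ (n : ℤ) (x : A.X n),
    (∀ (i m : ℤ) (h : i + n = m), (N : ℤ) ≤ i → ∀ a : A.X i, A.mul h a x = 0) → x = 0 := by
  induction N with
  | zero =>
    intro n x hx
    rw [← A.one_mul x]
    exact hx 0 n _ le_rfl _
  | succ N ih =>
    intro n x hx
    refine (injective_iff_map_eq_zero _).1 (hA.leftMul_injective he n) x
      (funext fun j => ih (n + 1) _ fun i m h hi a => ?_)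
    change A.mul h a (A.mul (add_comm 1 n) (t j) x) = 0
    rw [← A.mul_assoc (rfl : i + 1 = i + 1) (add_comm 1 n) (by omega) h]
    exact hx _ _ _ (by push_cast; omega) _

namespace Comparison

variable {W : WordResolution R e} {F : CochainComplex (ModuleCat.{u} R) ℤ}
  {π : F ⟶ residueComplex R} (c : Comparison W F π)

lemma bijective_leftMul (n : ℤ) :
    Function.Bijective ((boundedIdeal F).proj.targetModule.leftMul c.genClass n) := by
  constructor
  · rw [injective_iff_map_eq_zero]
    intro b hb
    induction b using Submodule.Quotient.induction_on with
    | H b =>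
      refine (Submodule.Quotient.mk_eq_zero _).2 ((boundedIdeal F).mem_bdy.2 ?_)
      refine c.isStablyNull_of_comp_gen b.1 b.2 fun i => ?_
      exact (boundedIdeal F).mem_bdy.1 ((mk_submoduleOf_eq_zero
        (p := (boundedIdeal F).bdy (n + 1)) ((boundedIdeal F).cmul_mem_cyc (add_comm 1 n)
          (by rw [DGIdeal.mem_cyc, show (1 : ℤ) + 1 = 2 by rfl, c.δ_gen]; exact zero_mem _)
          b.2)).1 (congrFun hb i))
  · intro y
    choose β hβ using fun i => Submodule.Quotient.mk_surjective _ (y i)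
    obtain ⟨α, hα, h⟩ := c.exists_comp_gen (fun i => (β i).1) fun i => (β i).2
    refine ⟨Submodule.Quotient.mk ⟨α, hα⟩, funext fun i => ?_⟩
    rw [← hβ i]
    exact (Submodule.Quotient.eq _).2 ((boundedIdeal F).mem_bdy.2 (h i))

/-- The long exact sequence breaks into short ones because the map from bounded to absolute
cohomology is zero. -/
theorem isInvertingExtension [F.IsKProjective] [QuasiIso π] (he : 0 < e)
    (hF : ∀ p, 0 < p → Limits.IsZero (F.X p)) :
    IsInvertingExtension c.genClass (boundedIdeal F).proj.toGrHom (boundedIdeal F).connecting := by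
  have hle : ∀ n {α : Cochain F F n}, α ∈ (zeroIdeal F).cyc n → α ∈ (boundedIdeal F).cyc n := by
    intro n α hα
    rw [DGIdeal.mem_cyc, DGIdeal.δ_eq_zero_of_cyc hα]
    exact zero_mem _
  -- The bounded summand `b` is itself a cocycle. Its class is killed by all classes of large
  -- degree, hence zero in a free algebra. This yields both injectivity of `ι` and surjectivity of
  -- `ð`.
  have hinj : ∀ n (α : (zeroIdeal F).cyc n), IsStablyNull α.1 → α.1 ∈ (zeroIdeal F).bdy n := by
    rintro n α ⟨γ, b, hb, h⟩
    have hb' : δ n (n + 1) b = 0 := by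
      rw [← add_sub_cancel_left (δ (n - 1) n γ) b, h, δ_sub, δ_δ, sub_zero]
      exact DGIdeal.δ_eq_zero_of_cyc α.2
    have hb0 : b ∈ (zeroIdeal F).cyc n := by
      rw [DGIdeal.mem_cyc, hb']
      exact zero_mem _
    obtain ⟨K, hK⟩ := hb.exists_comp_eq_zero hF
    have key := c.isFreeOn.eq_zero_of_mul_eq_zero he K n (Submodule.Quotient.mk ⟨b, hb0⟩)
      fun i m h hi a => by
        induction a using Submodule.Quotient.induction_on with
        | H a =>
          refine (mk_submoduleOf_eq_zero (p := (zeroIdeal F).bdy m)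
            ((zeroIdeal F).cmul_mem_cyc h a.2 hb0)).2 ?_
          change b.comp a.1 (show n + i = m by omega) ∈ _
          rw [hK i m (by omega) hi]
          exact zero_mem _
    rw [← h]
    exact add_mem ((zeroIdeal F).δ_mem_bdy γ) ((mk_submoduleOf_eq_zero hb0).1 key)
  refine ⟨fun n => ?_, fun n b => ⟨fun hb => ?_, ?_⟩, fun n x => ?_, c.bijective_leftMul,
    fun n x => ?_⟩
  · rw [injective_iff_map_eq_zero]
    intro a ha
    induction a using Submodule.Quotient.induction_on with
    | H a =>
      exact (Submodule.Quotient.mk_eq_zero _).2 (hinj n a ((boundedIdeal F).mem_bdy.1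
        ((mk_submoduleOf_eq_zero (p := (boundedIdeal F).bdy n) (hle n a.2)).1 ha)))
  · induction b using Submodule.Quotient.induction_on with
    | H b =>
      have hmem : δ n (n + 1) b.1 ∈ (boundedIdeal F).subCyc (n + 1) :=
        ⟨b.2, δ_δ n (n + 1) (n + 1 + 1) b.1⟩
      obtain ⟨b', hb', h⟩ := exists_δ_of_subBdy rfl
        ((mk_submoduleOf_eq_zero (p := (boundedIdeal F).subBdy (n + 1)) hmem).1 hb)
      have h0 : b.1 - b' ∈ (zeroIdeal F).cyc n := by
        rw [DGIdeal.mem_cyc, δ_sub, h, sub_self]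
        exact zero_mem _
      refine ⟨Submodule.Quotient.mk ⟨b.1 - b', h0⟩, (Submodule.Quotient.eq _).2 ?_⟩
      change b.1 - b' - b.1 ∈ (boundedIdeal F).bdy n
      rw [sub_sub_cancel_left]
      exact neg_mem (Submodule.mem_sup_right hb')
  · rintro ⟨a, rfl⟩
    induction a using Submodule.Quotient.induction_on with
    | H a =>
      refine (Submodule.Quotient.mk_eq_zero _).2 ?_
      change δ n (n + 1) a.1 ∈ (boundedIdeal F).subBdy (n + 1)
      rw [DGIdeal.δ_eq_zero_of_cyc a.2]
      exact zero_mem _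
  · induction x using Submodule.Quotient.induction_on with
    | H x =>
      obtain ⟨b, hb, hb'⟩ := x
      obtain ⟨γ, rfl⟩ := exists_δ_of_bdy_zeroIdeal rfl (hinj (n + 1) ⟨b, by
        rw [DGIdeal.mem_cyc, show δ (n + 1) (n + 1 + 1) b = 0 from hb']
        exact zero_mem _⟩ (IsBounded.isStablyNull hb))
      exact ⟨Submodule.Quotient.mk ⟨γ, hb⟩, rfl⟩
  · induction x using Submodule.Quotient.induction_on with
    | H x =>
      obtain ⟨K, hK⟩ := IsBounded.exists_comp_eq_zero hF x.2.1
      refine ⟨K, fun i m h hi a => ?_⟩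
      induction a using Submodule.Quotient.induction_on with
      | H a =>
        change (i * 1).negOnePow • (boundedIdeal F).cohomologyMod.act _ _ _ = 0
        have h0 : (boundedIdeal F).cohomologyMod.act (show i + (n + 1) = m + 1 by omega)
            (Submodule.Quotient.mk a) (Submodule.Quotient.mk x) = 0 := by
          refine (mk_submoduleOf_eq_zero (p := (boundedIdeal F).subBdy (m + 1))
            ((boundedIdeal F).cmul_mem_subCyc (by omega) a.2 x.2)).2 ?_
          change x.1.comp a.1 (show n + 1 + i = m + 1 by omega) ∈ _
          rw [hK i _ _ hi]
          exact zero_mem _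
        rw [h0, smul_zero]

end Comparison

end Extension

/-! ### From a basis of 𝔪/𝔪² to a word resolution. -/

section Generators

variable {R : Type u} [CommRing R] [IsLocalRing R]

/-- The word resolution defined by a minimal system of generators of the maximal ideal. -/
noncomputable def WordResolution.ofGenerators {e : ℕ} (x : Fin e → R)
    (hx : ∀ a b, x a * x b = 0) (hmem : ∀ a, x a ∈ IsLocalRing.maximalIdeal R)
    (hspan : ∀ y ∈ IsLocalRing.maximalIdeal R, ∃ r : Fin e → R, y = ∑ a, x a * r a)
    (hind : ∀ r : Fin e → R, ∑ a, x a * r a = 0 → ∀ a, r a ∈ IsLocalRing.maximalIdeal R) :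
    WordResolution R e where
  G := wordComplex x hx
  isKProjective := inferInstance
  aug := wordAug x hx hmem
  quasiIso := quasiIso_wordAug x hx hmem hspan hind
  tail := tailCochain x hx
  cons := consCochain x hx
  δ_tail := δ_tailCochain x hx
  cons_tail := consCochain_comp_tailCochain x hx
  empty := emptyCochain x hx
  empty_add := sub_add_cancel _ _
  empty_v _ hp := emptyCochain_v x hx hp
  δ_eq_zero _ _ z := δ_residue x hx z hmem
  eq_zero _ hn := residue_cochain_eq_zero x hx hn
  empty_comp _ hn := emptyCochain_comp x hx hn
  exists_smul_aug := exists_smul_wordAug x hx hmem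
  smul_aug_eq_zero_iff := smul_wordAug_eq_zero_iff x hx hmem

/-- Since 𝔪² = 0, the maximal ideal is its own cotangent space. Lifting a basis therefore gives
generators of 𝔪 whose only relations have coefficients in 𝔪. -/
lemma nonempty_wordResolution [IsNoetherianRing R]
    (hsq : IsLocalRing.maximalIdeal R ^ 2 = ⊥) :
    Nonempty (WordResolution R (Module.finrank (IsLocalRing.ResidueField R)
      (IsLocalRing.CotangentSpace R))) := by
  let b := Module.finBasis (IsLocalRing.ResidueField R) (IsLocalRing.CotangentSpace R)
  choose x hx using fun a => Ideal.toCotangent_surjective _ (b a)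
  have hinj : ∀ y : IsLocalRing.maximalIdeal R,
      Ideal.toCotangent _ y = 0 → (y : R) = 0 := fun y hy => by
    rwa [Ideal.toCotangent_eq_zero, hsq] at hy
  have hsum : ∀ r : Fin _ → R, Ideal.toCotangent _ (∑ a, r a • x a) =
      ∑ a, IsLocalRing.residue R (r a) • b a := fun r => by
    rw [map_sum]
    refine Finset.sum_congr rfl fun a _ => ?_
    rw [map_smul, hx]
    rfl
  have hcoe : ∀ r : Fin _ → R, ((∑ a, r a • x a : IsLocalRing.maximalIdeal R) : R) =
      ∑ a, (x a : R) * r a := fun r => by simp [mul_comm]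
  refine ⟨.ofGenerators (fun a => (x a : R)) (fun a a' => ?_) (fun a => (x a).2)
    (fun y hy => ?_) fun r hr a => ?_⟩
  · have : (x a : R) * x a' ∈ IsLocalRing.maximalIdeal R ^ 2 := by
      rw [sq]
      exact Ideal.mul_mem_mul (x a).2 (x a').2
    rwa [hsq] at this
  · choose r hr using fun a => IsLocalRing.residue_surjective
      (b.repr (Ideal.toCotangent _ ⟨y, hy⟩) a)
    refine ⟨r, ?_⟩
    rw [← hcoe, ← sub_eq_zero]
    refine hinj (⟨y, hy⟩ - ∑ a, r a • x a) ?_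
    rw [map_sub, hsum, sub_eq_zero]
    simp only [hr]
    exact (b.sum_repr _).symm
  · rw [← IsLocalRing.residue_eq_zero_iff]
    refine Fintype.linearIndependent_iff.1 b.linearIndependent
      (fun a => IsLocalRing.residue R (r a)) ?_ a
    rw [← hsum, ← (Ideal.toCotangent _).map_zero]
    congr 1
    exact Subtype.ext ((hcoe r).trans hr)

end Generators

end StableExt

/-! ### The main theorem. -/

theorem mainTheorem7 {R : Type u} [CommRing R] [IsLocalRing R] [IsNoetherianRing R]
    (hsq : IsLocalRing.maximalIdeal R ^ 2 = ⊥)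
    (e : ℕ) (hedim : Module.finrank (IsLocalRing.ResidueField R) (IsLocalRing.CotangentSpace R) = e)
    (he : 2 ≤ e)
    (P : ProjectiveResolution (ModuleCat.of R (IsLocalRing.ResidueField R))) :
    (∃ φ : StableExt.GrHom ((StableExt.boundedExt P).shift 1)
        (StableExt.shiftSum ((StableExt.extAlg P).dual (IsLocalRing.ResidueField R)) e),
      (∀ n : ℤ, Function.Bijective (φ.app n)) ∧
      (∀ n : ℤ, Function.Injective ((StableExt.iota P).app n)) ∧
      (∀ n : ℤ, Function.Exact ((StableExt.iota P).app n) ((φ.comp (StableExt.eth P)).app n)) ∧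
      (∀ n : ℤ, Function.Surjective ((φ.comp (StableExt.eth P)).app n))) ∧
    (¬ ∃ T : Submodule (StableExt.extAlg P).Total (StableExt.stableExt P).Total,
      IsCompl (LinearMap.range (StableExt.iota P).total) T) ∧
    (∀ n : ℕ, Subsingleton (Abelian.Ext
      (ModuleCat.of (StableExt.extAlg P).Total (StableExt.extAlg P).Residue)
      (ModuleCat.of (StableExt.extAlg P).Total (StableExt.stableExt P).Total) n)) := by
  subst hedim
  have he' := Nat.lt_of_lt_of_le two_pos he
  obtain ⟨W⟩ := StableExt.nonempty_wordResolution hsq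
  obtain ⟨c⟩ := StableExt.nonempty_comparison W P.cochainComplex P.π'
  have hA := c.isFreeOn
  have h := c.isInvertingExtension he' fun p hp =>
    CochainComplex.isZero_of_isStrictlyLE P.cochainComplex 0 p hp
  obtain ⟨φ, hφ⟩ := h.exists_bijective_shiftSum hA he'
  refine ⟨⟨φ, hφ, h.injective, fun n y => ?_, fun n => (hφ n).2.comp (h.surjective n)⟩,
    h.not_exists_isCompl hA he', hA.subsingleton_ext h.bijective⟩
  rw [← h.exact n y]
  exact map_eq_zero_iff (φ.app n) (hφ n).1
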